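/- Let $K=\mathrm{SU}(2)$, $U=K\times K$, $K_*=\{(k,k):k\in K\}$. For $t\in\mathbb R$ put $m_t=\mathrm{diag}(e^{it/2},e^{-it/2})$, $a_t=(m_t,m_{-t})$, and let $A_*=\{a_t:0\le t<4\pi\}$, $A_*'=\{a_t: t\notin\pi\mathbb Z\}$. Let $da$ be the invariant measure on $A_*$ of total mass $\pi$, i.e. $\int_{A_*}f(a)\,da=\frac14\int_0^{4\pi}f(a_t)\,dt$, and $D_*(a_t)=\sin^2t$. For $\ell\in\frac12\mathbb N$ let $H^\ell=\mathbb C[x,y]_{2\ell}$, with the inner product for which $\psi^\ell_j=\binom{2\ell}{\ell-j}^{1/2}x^{\ell-j}y^{\ell+j}$, $j=-\ell,-\ell+1,\dots,\ell$, is an orthonormal basis, and let $T^\ell(k)p=p\circ k^{t}$ for $k\in K$, where $k^t$ is the transpose. Put $T^{\ell_1,\ell_2}(k_1,k_2)=T^{\ell_1}(k_1)\otimes T^{\ell_2}(k_2)$. If $|\ell_1-\ell_2|\le\ell\le\ell_1+\ell_2$ and $\ell_1+\ell_2-\ell\in\mathbb Z$, let $\beta=\beta^{\ell_1,\ell_2}_\ell:H^\ell\to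 H^{\ell_1}\otimes H^{\ell_2}$ be the isometric $K$-intertwiner (for $K\cong K_*$), which is unique up to a scalar of modulus one, and let $\Phi^\ell_{\ell_1,\ell_2}(x)=\beta^*T^{\ell_1,\ell_2}(x)\beta\in\mathrm{End}(H^\ell)$ for $x\in U$. Endomorphisms of $H^\ell$ are identified with matrices in the basis $\psi^\ell_j$. For $d\in\mathbb N=\{0,1,2,\dots\}$ the full spherical function $\Phi^\ell_d:A_*\to\mathrm{End}(H^\ell)$ is given by $$(\Phi^\ell_d(a))_{p,q}=\bigl(\Phi^\ell_{(d+\ell+p)/2,\,(d+\ell-p)/2}(a)\bigr)_{q,q},\qquad p,q\in\{-\ell,\dots,\ell\}.$$ Put $Q^\ell_d(a)=\Phi^\ell_d(a)\Phi^\ell_0(a)^{-1}$ for $a\in A_*'$ (the four points of $A_*\setminus A_*'$ form a null set) and $V^\ell(a)=\Phi^\ell_0(a)\Phi^\ell_0(a)^*|D_*(a)|$. For $\mathrm{End}(H^\ell)$-valued functions on $A_*$ define $$\langle\Phi,\Psi\rangle=\frac2\pi\int_{A_*}\Phi(a)\Psi(a)^*|D_*(a)|\,da,\qquad \langle Q,R\rangle_{V^\ell}=\int_{A_*}Q(a)V^\ell(a)R(a)^*\,da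 .$$ For a matrix weight $W$ let $L^2(W)$ be the set of measurable functions $P:A_*\to\mathrm{End}(H^\ell)$, taken up to equality almost everywhere, with $\int_{A_*}\mathrm{tr}(PWP^*)\,da<\infty$. A matrix-valued inner product on such a space of functions, assumed stable under sums and left multiplication by constant matrices, is a pairing that is linear in the first variable, satisfies $\langle MP,R\rangle=M\langle P,R\rangle$ for constant matrices $M$ and $\langle P,R\rangle^*=\langle R,P\rangle$, has $\langle P,P\rangle\ge0$, and is such that $\langle P,P\rangle=0$ only if $P=0$ (almost everywhere). Then for every $\ell\in\frac12\mathbb N$: 1. The integrals defining $\langle\cdot,\cdot\rangle$ converge on $L^2(|D_*|I)$, and $\langle\cdot,\cdot\rangle$ is a matrix-valued inner product there. Every continuous function belongs to this space, and a continuous $\Phi$ with $\langle\Phi,\Phi\rangle=0$ vanishes identically. 2. The functions $\Phi^\ell_d$ are continuous and orthogonal: for all $d,d'\in\mathbb N$ and $p,q\in\{-\ell,\dots,\ell\}$, $$\langle\Phi^\ell_d,\Phi^\ell_{d'}\rangle_{p,q}=\delta_{d,d'}\,\delta_{p,q}\,\frac{(2\ell+1)^2}{(d+\ell+p+1)(d+\ell-p+1)}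 .$$ 3. $\Phi^\ell_0(a)$ is invertible for every $a\in A_*'$. The integrals defining $\langle\cdot,\cdot\rangle_{V^\ell}$ converge on $L^2(V^\ell)$, and $\langle\cdot,\cdot\rangle_{V^\ell}$ is a matrix-valued inner product there. Every continuous function belongs to this space, and a continuous $Q$ with $\langle Q,Q\rangle_{V^\ell}=0$ vanishes identically. 4. The functions $Q^\ell_d$ belong to $L^2(V^\ell)$ and are orthogonal: for all $d,d'\in\mathbb N$ and $p,q\in\{-\ell,\dots,\ell\}$, $$\bigl(\langle Q^\ell_d,Q^\ell_{d'}\rangle_{V^\ell}\bigr)_{p,q}=\frac\pi2\,\delta_{d,d'}\,\delta_{p,q}\,\frac{(2\ell+1)^2}{(d+\ell+p+1)(d+\ell-p+1)} .$$ -/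

import Mathlib

open MeasureTheory
open scoped Kronecker Matrix

/-!
Conventions. A half-integer `ℓ ∈ ½ℕ` is encoded by the natural number `L = 2ℓ`. An index
`j ∈ {-ℓ, -ℓ + 1, …, ℓ}` is encoded by `i = ℓ + j ∈ {0, …, L}`, that is, by `i : Fin (L + 1)`.
Endomorphisms of `H^ℓ` are written as matrices in the orthonormal basis `ψ^ℓ_j`, so that the
Hilbert space adjoint is the conjugate transpose.
-/

noncomputable section

namespace SphericalSU2

open scoped ComplexOrder

/-- `K = SU(2)`. -/
abbrev K : Type := Matrix.specialUnitaryGroup (Fin 2) ℂ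

/-- `U = K × K`; the subgroup `K_*` is the diagonal `{(k, k)}`. -/
abbrev U : Type := K × K

/-- The index `j = i - ℓ ∈ {-ℓ, …, ℓ}` encoded by `i : Fin (2ℓ + 1)`. -/
def idx (L : ℕ) (i : Fin (L + 1)) : ℝ := (i : ℝ) - (L : ℝ) / 2

/-- `ψ^ℓ_j = binom(2ℓ, ℓ - j)^{1/2} x^{ℓ - j} y^{ℓ + j}`, an element of `ℂ[x, y]_{2ℓ}`. -/
def psi (L : ℕ) (i : Fin (L + 1)) : MvPolynomial (Fin 2) ℂ :=
  MvPolynomial.C ((Real.sqrt (L.choose (L - i)) : ℝ) : ℂ) *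
    (MvPolynomial.X 0 ^ (L - (i : ℕ)) * MvPolynomial.X 1 ^ (i : ℕ))

/-- The action `p ↦ p ∘ kᵗ` of a matrix on polynomials in two variables. -/
def act (k : Matrix (Fin 2) (Fin 2) ℂ) :
    MvPolynomial (Fin 2) ℂ →ₐ[ℂ] MvPolynomial (Fin 2) ℂ :=
  MvPolynomial.aeval fun i => ∑ j, MvPolynomial.C (kᵀ i j) * MvPolynomial.X j

/-- The exponent of the monomial `x^{ℓ - j} y^{ℓ + j}`. -/
def expo (L : ℕ) (i : Fin (L + 1)) : Fin 2 →₀ ℕ :=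
  Finsupp.single 0 (L - (i : ℕ)) + Finsupp.single 1 (i : ℕ)

/-- The matrix of the representation `T^ℓ(k) : p ↦ p ∘ kᵗ` of `K` on `H^ℓ = ℂ[x, y]_{2ℓ}` in the
basis `ψ^ℓ_j`: the `(i, j)` entry is the coefficient of `ψ_i` in `T^ℓ(k) ψ_j`. -/
def T (L : ℕ) (k : K) : Matrix (Fin (L + 1)) (Fin (L + 1)) ℂ :=
  Matrix.of fun i j =>
    MvPolynomial.coeff (expo L i) (act k (psi L j)) / MvPolynomial.coeff (expo L i) (psi L i)

/-- The outer tensor product `T^{ℓ₁, ℓ₂}(k₁, k₂) = T^{ℓ₁}(k₁) ⊗ T^{ℓ₂}(k₂)` of `U` on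
`H^{ℓ₁} ⊗ H^{ℓ₂}`, as a matrix in the orthonormal basis `ψ^{ℓ₁}_{j₁} ⊗ ψ^{ℓ₂}_{j₂}`. -/
def T₂ (L₁ L₂ : ℕ) (x : U) :
    Matrix (Fin (L₁ + 1) × Fin (L₂ + 1)) (Fin (L₁ + 1) × Fin (L₂ + 1)) ℂ :=
  T L₁ x.1 ⊗ₖ T L₂ x.2

/-- `β : H^ℓ → H^{ℓ₁} ⊗ H^{ℓ₂}` is an isometric intertwiner for the action of `K ≅ K_*`. When
`|ℓ₁ - ℓ₂| ≤ ℓ ≤ ℓ₁ + ℓ₂` and `ℓ₁ + ℓ₂ - ℓ ∈ ℤ`, such a `β` exists and, the restriction to `K_*`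
being multiplicity free, is unique up to a scalar of modulus one; its matrix entries are the
normalized Clebsch–Gordan coefficients. -/
structure IsIsometricIntertwiner (L₁ L₂ L : ℕ)
    (β : Matrix (Fin (L₁ + 1) × Fin (L₂ + 1)) (Fin (L + 1)) ℂ) : Prop where
  isometry : βᴴ * β = 1
  intertwines : ∀ k : K, T₂ L₁ L₂ (k, k) * β = β * T L k

open Classical in
/-- The embedding `β^{ℓ₁, ℓ₂}_ℓ`; the spherical function below does not depend on the choice of
the scalar of modulus one. -/
def beta (L₁ L₂ L : ℕ) : Matrix (Fin (L₁ + 1) × Fin (L₂ + 1)) (Fin (L + 1)) ℂ :=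
  if h : ∃ β, IsIsometricIntertwiner L₁ L₂ L β then h.choose else 0

/-- The spherical function `Φ^ℓ_{ℓ₁, ℓ₂}(x) = β* ∘ T^{ℓ₁, ℓ₂}(x) ∘ β` on `U`. -/
def sph (L L₁ L₂ : ℕ) (x : U) : Matrix (Fin (L + 1)) (Fin (L + 1)) ℂ :=
  (beta L₁ L₂ L)ᴴ * T₂ L₁ L₂ x * beta L₁ L₂ L

/-- `m_t = diag(e^{it/2}, e^{-it/2}) ∈ K`. -/
def m (t : ℝ) : K :=
  ⟨!![Complex.exp (Complex.I * t / 2), 0; 0, Complex.exp (-(Complex.I * t / 2))], by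
    have hc : (starRingEnd ℂ) (Complex.I * t / 2) = -(Complex.I * t / 2) := by
      rw [map_div₀, map_mul, Complex.conj_I, Complex.conj_ofReal, map_ofNat]
      ring
    rw [Matrix.mem_specialUnitaryGroup_iff, Matrix.mem_unitaryGroup_iff]
    constructor
    · ext i j
      fin_cases i <;> fin_cases j <;>
        simp [Matrix.mul_apply, Matrix.star_apply, ← Complex.exp_conj, ← Complex.exp_add, hc]
    · simp [Matrix.det_fin_two, ← Complex.exp_add]⟩

/-- `A_* = {(m_t, m_{-t}) : 0 ≤ t < 4π} ⊂ U`. -/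
def A : Type := {x : U // ∃ t ∈ Set.Ico (0 : ℝ) (4 * Real.pi), x = (m t, m (-t))}

instance : TopologicalSpace A :=
  inferInstanceAs (TopologicalSpace {x : U // ∃ t ∈ Set.Ico (0 : ℝ) (4 * Real.pi),
    x = (m t, m (-t))})

instance : MeasurableSpace A := borel A

instance : BorelSpace A := ⟨rfl⟩

theorem m_add_period (t : ℝ) (n : ℤ) : m (t - n • (4 * Real.pi)) = m t := by
  have h1 : Complex.exp (Complex.I * ((t - n • (4 * Real.pi) : ℝ) : ℂ) / 2) =
      Complex.exp (Complex.I * t / 2) := by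
    rw [Complex.exp_eq_exp_iff_exists_int]
    refine ⟨-n, ?_⟩
    push_cast [zsmul_eq_mul]
    ring
  apply Subtype.ext
  simp only [m, Complex.exp_neg, h1]

/-- The point `a_t = (m_t, m_{-t})` of `A_*`. -/
def a (t : ℝ) : A :=
  ⟨(m t, m (-t)), by
    have hp : (0 : ℝ) < 4 * Real.pi := by positivity
    refine ⟨toIcoMod hp 0 t, by simpa using toIcoMod_mem_Ico hp 0 t, ?_⟩
    have h2 : -(t - toIcoDiv hp 0 t • (4 * Real.pi)) =
        -t - (-toIcoDiv hp 0 t) • (4 * Real.pi) := by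
      rw [neg_smul]; ring
    rw [toIcoMod, m_add_period, h2, m_add_period]⟩

/-- The invariant measure `da` on `A_*`, normalized to have total mass `π`: the image under
`t ↦ a_t` of `dt / 4` on `[0, 4π)`. -/
def da : Measure A :=
  Measure.map a (ENNReal.ofReal (1 / 4) • volume.restrict (Set.Ico (0 : ℝ) (4 * Real.pi)))

/-- The function `D_*` on `A_*`, `D_*(a_t) = sin² t`. -/
def D (x : A) : ℝ := (((x.1.1 : Matrix (Fin 2) (Fin 2) ℂ) 0 0 ^ 2).im) ^ 2

theorem D_a (t : ℝ) : D (a t) = Real.sin t ^ 2 := by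
  have h : Complex.exp (Complex.I * t / 2) ^ 2 = Complex.exp (t * Complex.I) := by
    rw [← Complex.exp_nat_mul]
    congr 1
    push_cast
    ring
  simp only [D, a, m, Matrix.of_apply, Matrix.cons_val', Matrix.cons_val_zero, h,
    Complex.exp_ofReal_mul_I_im]

/-- The regular part `A_*' = {a_t : t ∉ πℤ}`. -/
def Areg : Set A := {x | ∃ t : ℝ, (∀ n : ℤ, t ≠ n * Real.pi) ∧ x = a t}

/-- Functions on `A_*` with values in `End(H^ℓ)`. -/
abbrev Fn (L : ℕ) : Type := A → Matrix (Fin (L + 1)) (Fin (L + 1)) ℂ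

/-- The full spherical function `Φ^ℓ_d` on `A_*`: `(Φ^ℓ_d(a))_{p,q} = (Φ^ℓ_{ζ(d,p)}(a))_{q,q}`
with `ζ(d,p) = ((d + ℓ + p)/2, (d + ℓ - p)/2)`. For `p` encoded by `i = ℓ + p`, the doubled
coordinates of `ζ(d,p)` are `d + i` and `d + (2ℓ - i)`. -/
def Phi (L d : ℕ) : Fn L := fun x =>
  Matrix.of fun p q => sph L (d + (p : ℕ)) (d + (L - (p : ℕ))) x.1 q q

/-- The full spherical polynomial `Q^ℓ_d(a) = Φ^ℓ_d(a) Φ^ℓ_0(a)⁻¹` (meaningful on `A_*'`, whose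
complement is finite). -/
def Q (L d : ℕ) : Fn L := fun x => Phi L d x * (Phi L 0 x)⁻¹

/-- The integral over `A_*` of a matrix valued function, entry by entry. -/
def matInt {L : ℕ} (F : Fn L) : Matrix (Fin (L + 1)) (Fin (L + 1)) ℂ :=
  Matrix.of fun i j => ∫ x, F x i j ∂da

/-- The matrix valued pairing `⟨Φ, Ψ⟩ = (2/π) ∫_{A_*} Φ(a) Ψ(a)* |D_*(a)| da`. -/
def pairing {L : ℕ} (Φ Ψ : Fn L) : Matrix (Fin (L + 1)) (Fin (L + 1)) ℂ :=
  ((2 / Real.pi : ℝ) : ℂ) • matInt fun x => ((|D x| : ℝ) : ℂ) • (Φ x * (Ψ x)ᴴ)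

/-- The matrix weight `V^ℓ(a) = Φ^ℓ_0(a) Φ^ℓ_0(a)* |D_*(a)|`. -/
def V (L : ℕ) : Fn L := fun x => ((|D x| : ℝ) : ℂ) • (Phi L 0 x * (Phi L 0 x)ᴴ)

/-- The matrix valued pairing `⟨Q, R⟩_V = ∫_{A_*} Q(a) V^ℓ(a) R(a)* da`. -/
def pairingV {L : ℕ} (P R : Fn L) : Matrix (Fin (L + 1)) (Fin (L + 1)) ℂ :=
  matInt fun x => P x * V L x * (R x)ᴴ

/-- The scalar weight `|D_*|` times the identity matrix. -/
def DI (L : ℕ) : Fn L := fun x => ((|D x| : ℝ) : ℂ) • 1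

/-- The functions on `A_*` that are square integrable for the matrix weight `W`: measurable up to
a null set, with `∫ tr (P W P*) da < ∞`. -/
def L2 {L : ℕ} (W : Fn L) : Set (Fn L) :=
  {P | (∀ i j, AEStronglyMeasurable (fun x => P x i j) da) ∧
    ∀ i, Integrable (fun x => (P x * W x * (P x)ᴴ) i i) da}

/-- `B` is a matrix valued inner product on the set `S` of functions on `A_*`, functions that agree
`da`-almost everywhere being identified: `S` is a left module over the matrices, and `B` is linear
in the first variable, Hermitian and positive definite. -/
structure IsMatrixInnerProduct {L : ℕ} (S : Set (Fn L))
    (B : Fn L → Fn L → Matrix (Fin (L + 1)) (Fin (L + 1)) ℂ) : Prop where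
  zero_mem : (0 : Fn L) ∈ S
  add_mem : ∀ P ∈ S, ∀ R ∈ S, P + R ∈ S
  mul_mem : ∀ (M : Matrix (Fin (L + 1)) (Fin (L + 1)) ℂ), ∀ P ∈ S, (fun x => M * P x) ∈ S
  linear : ∀ (c₁ c₂ : ℂ), ∀ P₁ ∈ S, ∀ P₂ ∈ S, ∀ R ∈ S,
    B (c₁ • P₁ + c₂ • P₂) R = c₁ • B P₁ R + c₂ • B P₂ R
  mul_left : ∀ (M : Matrix (Fin (L + 1)) (Fin (L + 1)) ℂ), ∀ P ∈ S, ∀ R ∈ S,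
    B (fun x => M * P x) R = M * B P R
  hermitian : ∀ P ∈ S, ∀ R ∈ S, (B P R)ᴴ = B R P
  nonneg : ∀ P ∈ S, (B P P).PosSemidef
  definite : ∀ P ∈ S, B P P = 0 → P =ᵐ[da] 0

end SphericalSU2

end

noncomputable section

namespace SphericalSU2

/-! The orthogonality is Schur orthogonality on `U`, pushed down to the torus by the Weyl
integration formula. Since `Φ(a_t)` commutes with every `T^ℓ(m_s)`, it is diagonal. Row `p` of `Φ_d`
is the diagonal of the spherical function with label `ζ(d,p)`, so the `(p,q)` entry of `Φ_d Φ_{d'}*`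
is the trace form `tr (Φ_{ζ(d,p)} Φ_{ζ(d',q)}*)`. This form is bi-invariant under `K_*`. Hence its
integral over `U` equals the integral of a class function on `K`, and Weyl's formula turns that into
an integral over `A_*` with density `sin² t`. Schur orthogonality evaluates the integral over `U`
(`integral_sphForm_haarU`), and `ζ` is injective.

The tools are developed from binary forms. Entries of `T^ℓ` are compared through generating
functions in an evaluation point (`sum_ev_mul_Tm`, `ev_ext`). Schur's lemma comes from torus weights
together with one explicit rotation that mixes them. The intertwiners `β` exist because `∫ χ_{ℓ₁}
χ_{ℓ₂} conj χ_ℓ` equals 1, by a recursion for products of characters (`tripleInt_add`). Weyl's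
formula is checked on the class functions `cosK n`, whose integrals are the Fourier coefficients of
`sin²`.

For invertibility of `Φ_0`, the rows involve only `ℓ = ℓ₁ + ℓ₂`, where `β` is the transpose of
multiplication of polynomials. Up to invertible diagonal factors, `Φ_0(a_t)` is then the transpose
of the substitution operator of a `2 × 2` matrix of determinant `-2i sin t`
(`sqrt_choose_mul_Phi_zero`). Finally, a weight `G G* |D_*|` with `G` invertible off a null set
reduces to ordinary `L²` theory for the entries of `|D_*|^{1/2} P G`; `G = 1` and `G = Φ_0` give the
two inner products. -/

/-! ### The matrix coefficients of binary forms -/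

/-- The value of `ψ^ℓ_j` at `v`. -/
def ev (L : ℕ) (i : Fin (L + 1)) (v : Fin 2 → ℂ) : ℂ :=
  ((Real.sqrt (L.choose i) : ℝ) : ℂ) * (v 0 ^ (L - (i : ℕ)) * v 1 ^ (i : ℕ))

/-- The matrix of `p ↦ p ∘ gᵗ` on binary forms, for an arbitrary `2 × 2` matrix `g`. -/
def Tm (L : ℕ) (g : Matrix (Fin 2) (Fin 2) ℂ) : Matrix (Fin (L + 1)) (Fin (L + 1)) ℂ :=
  Matrix.of fun i j =>
    MvPolynomial.coeff (expo L i) (act g (psi L j)) / MvPolynomial.coeff (expo L i) (psi L i)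

theorem T_eq_Tm (L : ℕ) (k : K) : T L k = Tm L (k : Matrix (Fin 2) (Fin 2) ℂ) := rfl

theorem sqrt_choose_ne_zero {L : ℕ} (i : Fin (L + 1)) :
    ((Real.sqrt (L.choose i) : ℝ) : ℂ) ≠ 0 := by
  have : 0 < L.choose i := Nat.choose_pos (Nat.lt_succ_iff.mp i.2)
  rw [Complex.ofReal_ne_zero]
  positivity

theorem sqrt_choose_mul_self {L : ℕ} (i : Fin (L + 1)) :
    ((Real.sqrt (L.choose i) : ℝ) : ℂ) * ((Real.sqrt (L.choose i) : ℝ) : ℂ) = L.choose i := by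
  rw [← Complex.ofReal_mul, Real.mul_self_sqrt (by positivity)]
  simp

theorem psi_eq_monomial (L : ℕ) (i : Fin (L + 1)) :
    psi L i = MvPolynomial.monomial (expo L i) ((Real.sqrt (L.choose i) : ℝ) : ℂ) := by
  rw [psi, Nat.choose_symm (Nat.lt_succ_iff.mp i.2), MvPolynomial.X_pow_eq_monomial,
    MvPolynomial.X_pow_eq_monomial, MvPolynomial.monomial_mul, MvPolynomial.C_mul_monomial]
  simp [expo]

theorem eval_psi (L : ℕ) (i : Fin (L + 1)) (v : Fin 2 → ℂ) :
    MvPolynomial.eval v (psi L i) = ev L i v := by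
  simp [psi, ev, Nat.choose_symm (Nat.lt_succ_iff.mp i.2)]

theorem expo_injective (L : ℕ) : Function.Injective (expo L) := by
  intro i j h
  have := DFunLike.congr_fun h 1
  simpa [expo, Fin.ext_iff] using this

theorem coeff_psi (L : ℕ) (i j : Fin (L + 1)) :
    MvPolynomial.coeff (expo L i) (psi L j) =
      if i = j then ((Real.sqrt (L.choose i) : ℝ) : ℂ) else 0 := by
  rw [psi_eq_monomial, MvPolynomial.coeff_monomial]
  by_cases h : i = j
  · simp [h]
  · rw [if_neg h, if_neg (fun h' => h (expo_injective L h').symm)]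

theorem expo_degree (L : ℕ) (i : Fin (L + 1)) : (expo L i).degree = L := by
  have := i.2
  rw [expo, map_add, Finsupp.degree_single, Finsupp.degree_single]
  omega

theorem eq_expo_of_degree {L : ℕ} {d : Fin 2 →₀ ℕ} (h : d.degree = L) :
    ∃ i, d = expo L i := by
  have h' : d 0 + d 1 = L := by
    rw [← h, Finsupp.degree_eq_sum]; simp [Fin.sum_univ_two]
  refine ⟨⟨d 1, by omega⟩, ?_⟩
  ext j
  fin_cases j
  · simp [expo]; omega
  · simp [expo]

theorem psi_isHomogeneous (L : ℕ) (i : Fin (L + 1)) : (psi L i).IsHomogeneous L := by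
  rw [psi_eq_monomial]
  exact MvPolynomial.isHomogeneous_monomial _ (expo_degree L i)

/-- A binary form of degree `L` is a combination of the `ψ^ℓ_j`. -/
theorem eq_sum_psi {L : ℕ} {p : MvPolynomial (Fin 2) ℂ} (hp : p.IsHomogeneous L) :
    p = ∑ i, MvPolynomial.C (MvPolynomial.coeff (expo L i) p /
      MvPolynomial.coeff (expo L i) (psi L i)) * psi L i := by
  ext d
  rw [MvPolynomial.coeff_sum]
  simp_rw [MvPolynomial.coeff_C_mul]
  by_cases hd : d.degree = L
  · obtain ⟨i, rfl⟩ := eq_expo_of_degree hd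
    rw [Finset.sum_eq_single i]
    · rw [coeff_psi, if_pos rfl, div_mul_cancel₀ _ (sqrt_choose_ne_zero i)]
    · intro j _ hj
      rw [coeff_psi L i j, if_neg (Ne.symm hj), mul_zero]
    · simp
  · rw [hp.coeff_eq_zero hd]
    refine (Finset.sum_eq_zero fun j _ => ?_).symm
    rw [(psi_isHomogeneous L j).coeff_eq_zero hd, mul_zero]

theorem act_isHomogeneous {L : ℕ} (g : Matrix (Fin 2) (Fin 2) ℂ)
    {p : MvPolynomial (Fin 2) ℂ} (hp : p.IsHomogeneous L) : (act g p).IsHomogeneous L := by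
  have h := hp.aeval (S := ℂ) (fun i => ∑ j, MvPolynomial.C (gᵀ i j) * MvPolynomial.X j) (n := 1)
    (fun i => MvPolynomial.IsHomogeneous.sum _ _ _
      fun j _ => MvPolynomial.isHomogeneous_C_mul_X _ _)
  simpa [act] using h

theorem eval_act (g : Matrix (Fin 2) (Fin 2) ℂ) (p : MvPolynomial (Fin 2) ℂ) (v : Fin 2 → ℂ) :
    MvPolynomial.eval v (act g p) = MvPolynomial.eval (gᵀ *ᵥ v) p := by
  induction p using MvPolynomial.induction_on with
  | C c => simp [act]
  | add p q hp hq => simp [hp, hq]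
  | mul_X p i hp =>
    rw [map_mul, map_mul, hp, map_mul]
    congr 1
    fin_cases i <;> simp [act]

/-- This characterizes column `j` of `Tm L g` by its generating function. Together with `ev_ext` it
replaces all later manipulation of polynomial coefficients. -/
theorem sum_ev_mul_Tm (L : ℕ) (g : Matrix (Fin 2) (Fin 2) ℂ) (j : Fin (L + 1))
    (v : Fin 2 → ℂ) : ∑ i, ev L i v * Tm L g i j = ev L j (gᵀ *ᵥ v) := by
  rw [← eval_psi, ← eval_act, eq_sum_psi (act_isHomogeneous g (psi_isHomogeneous L j)), map_sum]
  refine Finset.sum_congr rfl fun i _ => ?_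
  rw [map_mul, MvPolynomial.eval_C, eval_psi, mul_comm]
  rfl

/-- A polynomial over the infinite field `ℂ` is determined by its values. -/
theorem ev_independent {L : ℕ} {c : Fin (L + 1) → ℂ} (h : ∀ v, ∑ i, ev L i v * c i = 0) :
    c = 0 := by
  have h0 : ∑ i, MvPolynomial.C (c i) * psi L i = 0 := by
    apply MvPolynomial.funext
    intro v
    rw [map_sum, map_zero, ← h v]
    exact Finset.sum_congr rfl fun i _ => by
      rw [map_mul, MvPolynomial.eval_C, eval_psi, mul_comm]
  ext i
  have := congrArg (MvPolynomial.coeff (expo L i)) h0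
  simp_rw [MvPolynomial.coeff_sum, MvPolynomial.coeff_C_mul, coeff_psi] at this
  simpa [(sqrt_choose_ne_zero i)] using this

theorem ev_ext {L : ℕ} {c d : Fin (L + 1) → ℂ}
    (h : ∀ v, ∑ i, ev L i v * c i = ∑ i, ev L i v * d i) : c = d := by
  rw [← sub_eq_zero]
  apply ev_independent
  intro v
  simp [mul_sub, h v]

theorem Tm_mul (L : ℕ) (g h : Matrix (Fin 2) (Fin 2) ℂ) : Tm L (g * h) = Tm L g * Tm L h := by
  ext i j
  refine congrFun (ev_ext (c := fun i => Tm L (g * h) i j)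
    (d := fun i => (Tm L g * Tm L h) i j) fun v => ?_) i
  rw [sum_ev_mul_Tm, Matrix.transpose_mul, ← Matrix.mulVec_mulVec, ← sum_ev_mul_Tm]
  simp_rw [← sum_ev_mul_Tm, Matrix.mul_apply, Finset.mul_sum, Finset.sum_mul, mul_assoc]
  exact Finset.sum_comm

theorem Tm_one (L : ℕ) : Tm L 1 = 1 := by
  ext i j
  refine congrFun (ev_ext (c := fun i => Tm L 1 i j)
    (d := fun i => (1 : Matrix _ _ ℂ) i j) fun v => ?_) i
  rw [sum_ev_mul_Tm]
  simp [Matrix.one_apply]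

/-- The binomial theorem; the square roots in `ψ^ℓ_j` are chosen to make this reproducing kernel a
pure power. -/
theorem sum_ev_mul_ev (L : ℕ) (v w : Fin 2 → ℂ) :
    ∑ i, ev L i v * ev L i w = (v 0 * w 0 + v 1 * w 1) ^ L := by
  rw [add_comm (v 0 * w 0), add_pow, Finset.sum_range]
  refine Finset.sum_congr rfl fun i _ => ?_
  rw [← sqrt_choose_mul_self]
  simp only [ev]
  ring

/-- The two-variable generating function of `Tm L g` is `(vᵗ g w)^L`, which is unchanged when `g` is
transposed and `v`, `w` are exchanged. With `Tm_conj` this yields unitarity of `T^ℓ`. -/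
theorem Tm_transpose (L : ℕ) (g : Matrix (Fin 2) (Fin 2) ℂ) : Tm L gᵀ = (Tm L g)ᵀ := by
  have key : ∀ (g : Matrix (Fin 2) (Fin 2) ℂ) (v w : Fin 2 → ℂ),
      ∑ i, ev L i v * ∑ j, ev L j w * Tm L g i j =
        (v 0 * (g 0 0 * w 0 + g 0 1 * w 1) + v 1 * (g 1 0 * w 0 + g 1 1 * w 1)) ^ L := by
    intro g v w
    have h1 : ∑ i, ev L i v * ∑ j, ev L j w * Tm L g i j =
        ∑ j, (∑ i, ev L i v * Tm L g i j) * ev L j w := by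
      simp_rw [Finset.mul_sum, Finset.sum_mul]
      rw [Finset.sum_comm]
      exact Finset.sum_congr rfl fun _ _ => Finset.sum_congr rfl fun _ _ => by ring
    rw [h1]
    simp_rw [sum_ev_mul_Tm]
    rw [sum_ev_mul_ev]
    simp [Matrix.mulVec, dotProduct, Fin.sum_univ_two]
    ring
  have h2 : ∀ w : Fin 2 → ℂ, (fun i => ∑ j, ev L j w * Tm L gᵀ i j) =
      fun i => ∑ j, ev L j w * (Tm L g)ᵀ i j := by
    intro w
    refine ev_ext fun v => ?_
    rw [key]
    simp_rw [Finset.mul_sum]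
    rw [Finset.sum_comm]
    have := key g w v
    simp_rw [Finset.mul_sum] at this
    calc _ = _ := ?_
      _ = _ := this.symm
      _ = _ := Finset.sum_congr rfl fun _ _ => Finset.sum_congr rfl fun _ _ => by
        rw [Matrix.transpose_apply]; ring
    simp only [Matrix.transpose_apply]
    ring
  ext i j
  exact congrFun (ev_ext (c := fun j => Tm L gᵀ i j) (d := fun j => (Tm L g)ᵀ i j)
    fun w => congrFun (h2 w) i) j

theorem star_ev (L : ℕ) (i : Fin (L + 1)) (v : Fin 2 → ℂ) : star (ev L i v) = ev L i (star v) := by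
  simp [ev]

theorem Tm_conj (L : ℕ) (g : Matrix (Fin 2) (Fin 2) ℂ) :
    Tm L (g.map star) = (Tm L g).map star := by
  ext i j
  refine congrFun (ev_ext (c := fun i => Tm L (g.map star) i j)
    (d := fun i => (Tm L g).map star i j) fun v => ?_) i
  rw [sum_ev_mul_Tm]
  have h := congrArg star (sum_ev_mul_Tm L g j (star v))
  rw [star_sum, star_ev] at h
  simp_rw [star_mul', star_ev, star_star] at h
  simp only [Matrix.map_apply]
  rw [h]
  congr 1
  ext l
  fin_cases l <;> simp [Matrix.mulVec]

theorem Tm_conjTranspose (L : ℕ) (g : Matrix (Fin 2) (Fin 2) ℂ) : Tm L gᴴ = (Tm L g)ᴴ := by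
  rw [Matrix.conjTranspose, Tm_conj, Tm_transpose]
  rfl

/-! ### The unitary representation `T^ℓ` of `SU(2)` -/

theorem T_mul (L : ℕ) (g h : K) : T L (g * h) = T L g * T L h := Tm_mul L _ _

theorem T_one (L : ℕ) : T L 1 = 1 := Tm_one L

theorem T_inv (L : ℕ) (k : K) : T L k⁻¹ = (T L k)ᴴ := Tm_conjTranspose L _

theorem conjTranspose_T_mul (L : ℕ) (k : K) : (T L k)ᴴ * T L k = 1 := by
  rw [← T_inv, ← T_mul, inv_mul_cancel, T_one]

theorem T_mul_conjTranspose (L : ℕ) (k : K) : T L k * (T L k)ᴴ = 1 := by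
  rw [← T_inv, ← T_mul, mul_inv_cancel, T_one]

theorem T_zero_apply (L : ℕ) (k : K) (j : Fin (L + 1)) :
    T L k 0 j = ev L j ((k : Matrix (Fin 2) (Fin 2) ℂ) 0) := by
  have h := sum_ev_mul_Tm L (k : Matrix (Fin 2) (Fin 2) ℂ) j ![1, 0]
  rw [Finset.sum_eq_single 0] at h
  · have e : (k : Matrix (Fin 2) (Fin 2) ℂ)ᵀ *ᵥ ![1, 0] = (k : Matrix (Fin 2) (Fin 2) ℂ) 0 := by
      ext l
      simp [Matrix.mulVec, dotProduct, Fin.sum_univ_two]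
    rw [e] at h
    rw [← h, T_eq_Tm]
    simp [ev]
  · intro i _ hi
    have : (i : ℕ) ≠ 0 := fun h => hi (Fin.ext h)
    simp [ev, this]
  · simp

/-- `T^ℓ` is diagonal on the maximal torus. -/
theorem T_m (L : ℕ) (t : ℝ) :
    T L (m t) = Matrix.diagonal fun j : Fin (L + 1) =>
      Complex.exp (((L : ℂ) - 2 * (j : ℕ)) * (t / 2) * Complex.I) := by
  ext i j
  refine congrFun (ev_ext (c := fun i => Tm L (m t).1 i j)
    (d := fun i => Matrix.diagonal (fun j : Fin (L + 1) =>
      Complex.exp (((L : ℂ) - 2 * (j : ℕ)) * (t / 2) * Complex.I)) i j) fun v => ?_) i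
  rw [sum_ev_mul_Tm, Finset.sum_eq_single j]
  · have hj : (j : ℕ) ≤ L := Nat.lt_succ_iff.mp j.2
    have e : Complex.exp (((L : ℂ) - 2 * (j : ℕ)) * (t / 2) * Complex.I) =
        Complex.exp (Complex.I * t / 2) ^ (L - (j : ℕ)) *
          Complex.exp (-(Complex.I * t / 2)) ^ (j : ℕ) := by
      rw [← Complex.exp_nat_mul, ← Complex.exp_nat_mul, ← Complex.exp_add]
      congr 1
      push_cast [hj]
      ring
    rw [Matrix.diagonal_apply_eq, e]
    simp [ev, m, Matrix.mulVec, dotProduct, Fin.sum_univ_two]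
    ring
  · intro i _ hi
    rw [Matrix.diagonal_apply_ne _ hi, mul_zero]
  · simp

/-- A family of polynomials all of whose coefficients depend continuously on the parameter. -/
def ContinuousCoeff {X : Type*} [TopologicalSpace X] (f : X → MvPolynomial (Fin 2) ℂ) : Prop :=
  ∀ d, Continuous fun x => MvPolynomial.coeff d (f x)

theorem ContinuousCoeff.mul {X : Type*} [TopologicalSpace X] {f g : X → MvPolynomial (Fin 2) ℂ}
    (hf : ContinuousCoeff f) (hg : ContinuousCoeff g) : ContinuousCoeff fun x => f x * g x := by
  intro d
  simp_rw [MvPolynomial.coeff_mul]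
  exact continuous_finsetSum _ fun p _ => (hf _).mul (hg _)

theorem ContinuousCoeff.pow {X : Type*} [TopologicalSpace X] {f : X → MvPolynomial (Fin 2) ℂ}
    (hf : ContinuousCoeff f) (n : ℕ) : ContinuousCoeff fun x => f x ^ n := by
  induction n with
  | zero => intro d; simpa using continuous_const
  | succ n ih => simpa only [pow_succ] using ih.mul hf

theorem continuous_T (L : ℕ) : Continuous (T L) := by
  refine continuous_matrix fun i j => ?_
  refine Continuous.div_const ?_ _
  have hX : ∀ l, ContinuousCoeff fun k : K => act (k : Matrix (Fin 2) (Fin 2) ℂ)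
      (MvPolynomial.X l) := by
    intro l d
    simp only [act, MvPolynomial.aeval_X, MvPolynomial.coeff_sum, MvPolynomial.coeff_C_mul,
      Matrix.transpose_apply]
    refine continuous_finsetSum _ fun p _ => Continuous.mul ?_ continuous_const
    exact (continuous_id.matrix_elem p l).comp continuous_subtype_val
  have hC : ∀ c : ℂ, ContinuousCoeff fun _ : K => MvPolynomial.C c := fun c d => continuous_const
  have := (hC ((Real.sqrt (L.choose (L - j)) : ℝ) : ℂ)).mul
    (((hX 0).pow (L - j)).mul ((hX 1).pow j))
  convert this (expo L i) using 2 with k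
  simp [psi]

/-! ### Schur's lemma -/

/-- Distinct weights are separated by a single torus element. -/
theorem weight_eq_of_intertwines {ι κ : Type*} [Fintype ι] [Fintype κ] [DecidableEq ι]
    [DecidableEq κ] {B : Matrix ι κ ℂ} {x : ι → ℤ} {y : κ → ℤ}
    (h : ∀ t : ℝ, (Matrix.diagonal fun i => Complex.exp ((x i : ℂ) * (t / 2) * Complex.I)) * B =
      B * Matrix.diagonal fun j => Complex.exp ((y j : ℂ) * (t / 2) * Complex.I))
    {i : ι} {j : κ} (hij : B i j ≠ 0) : x i = y j := by
  by_contra hne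
  have hn : ((x i : ℂ) - y j) ≠ 0 := by
    rw [sub_ne_zero]
    exact_mod_cast hne
  -- This `t` makes the two exponents differ by exactly `πi`, so equality of the exponentials would
  -- give `-1 = 1`.
  have h1 := congrFun (congrFun (h (2 * Real.pi / ((x i : ℝ) - y j))) i) j
  rw [Matrix.diagonal_mul, Matrix.mul_diagonal, mul_comm] at h1
  have h2 := mul_left_cancel₀ hij h1
  rw [← div_eq_one_iff_eq (Complex.exp_ne_zero _), ← Complex.exp_sub] at h2
  have h3 : (x i : ℂ) * ((2 * Real.pi / ((x i : ℝ) - y j) : ℝ) / 2) * Complex.I -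
      y j * ((2 * Real.pi / ((x i : ℝ) - y j) : ℝ) / 2) * Complex.I = Real.pi * Complex.I := by
    push_cast
    field_simp
  rw [h3, Complex.exp_pi_mul_I] at h2
  norm_num at h2

theorem T_m' (L : ℕ) (t : ℝ) :
    T L (m t) = Matrix.diagonal fun j : Fin (L + 1) =>
      Complex.exp ((((L : ℤ) - 2 * (j : ℕ) : ℤ) : ℂ) * (t / 2) * Complex.I) := by
  rw [T_m]
  push_cast
  rfl

theorem T_weight_eq {p q : ℕ} {B : Matrix (Fin (p + 1)) (Fin (q + 1)) ℂ}
    (h : ∀ k, T p k * B = B * T q k) {i : Fin (p + 1)} {j : Fin (q + 1)} (hij : B i j ≠ 0) :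
    (p : ℤ) - 2 * (i : ℕ) = (q : ℤ) - 2 * (j : ℕ) := by
  refine weight_eq_of_intertwines (x := fun i : Fin (p + 1) => (p : ℤ) - 2 * (i : ℕ))
    (y := fun j : Fin (q + 1) => (q : ℤ) - 2 * (j : ℕ)) (fun t => ?_) hij
  have := h (m t)
  rwa [T_m', T_m'] at this

/-- A rotation with non-zero entries. -/
def rot : K :=
  ⟨!![3 / 5, 4 / 5; -4 / 5, 3 / 5], by
    rw [Matrix.mem_specialUnitaryGroup_iff, Matrix.mem_unitaryGroup_iff]
    constructor
    · ext i j
      fin_cases i <;> fin_cases j <;>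
        simp [Matrix.mul_apply, Matrix.star_apply, map_ofNat] <;> norm_num [map_ofNat]
    · simp [Matrix.det_fin_two]; norm_num⟩

/-- Row `0` links the highest weight vector to every other basis vector, so this one element plays
the role of the raising operators in Schur's lemma. -/
theorem T_rot_ne_zero (L : ℕ) (j : Fin (L + 1)) : T L rot 0 j ≠ 0 := by
  rw [T_zero_apply]
  exact mul_ne_zero (sqrt_choose_ne_zero j) (by simp [rot])

theorem intertwines_conjTranspose {p q : ℕ} {B : Matrix (Fin (p + 1)) (Fin (q + 1)) ℂ}
    (h : ∀ k, T p k * B = B * T q k) (k : K) : T q k * Bᴴ = Bᴴ * T p k := by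
  have := congrArg Matrix.conjTranspose (h k⁻¹)
  rw [Matrix.conjTranspose_mul, Matrix.conjTranspose_mul, ← T_inv, ← T_inv, inv_inv] at this
  exact this.symm

/-- The weight `p` does not occur in `T q`, so row `0` of `B` vanishes. The rotation then carries
this to every row. -/
theorem schur_of_lt {p q : ℕ} (hpq : q < p) {B : Matrix (Fin (p + 1)) (Fin (q + 1)) ℂ}
    (h : ∀ k, T p k * B = B * T q k) : B = 0 := by
  have h0 : ∀ j, B 0 j = 0 := by
    intro j
    by_contra hne
    have := T_weight_eq h hne
    simp at this
    omega
  ext i j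
  by_contra hne
  -- Weights are simple, so column `j` of `B` has at most one nonzero entry and the left-hand sum
  -- has one term; the right-hand side involves only row `0` of `B`.
  have h1 := congrFun (congrFun (h rot) 0) j
  rw [Matrix.mul_apply, Matrix.mul_apply, Finset.sum_eq_single i] at h1
  · simp only [h0, zero_mul, Finset.sum_const_zero, mul_eq_zero] at h1
    exact h1.elim (T_rot_ne_zero p i) hne
  · intro i' _ hi'
    by_contra hne'
    have e1 := T_weight_eq h (right_ne_zero_of_mul hne')
    have e2 := T_weight_eq h hne
    exact hi' (Fin.ext (by omega))
  · simp

/-- Schur's lemma for inequivalent representations. -/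
theorem schur_of_ne {p q : ℕ} (hpq : p ≠ q) {B : Matrix (Fin (p + 1)) (Fin (q + 1)) ℂ}
    (h : ∀ k, T p k * B = B * T q k) : B = 0 := by
  rcases lt_or_gt_of_ne hpq with hlt | hlt
  · rw [← Matrix.conjTranspose_eq_zero]
    exact schur_of_lt hlt (intertwines_conjTranspose h)
  · exact schur_of_lt hlt h

/-- Schur's lemma: the commutant of `T^ℓ` consists of the scalars. -/
theorem schur_self {p : ℕ} {B : Matrix (Fin (p + 1)) (Fin (p + 1)) ℂ}
    (h : ∀ k, T p k * B = B * T p k) : B = B 0 0 • 1 := by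
  have hd : ∀ i j, i ≠ j → B i j = 0 := by
    intro i j hij
    by_contra hne
    have := T_weight_eq h hne
    exact hij (Fin.ext (by omega))
  ext i j
  by_cases hij : i = j
  · subst hij
    -- For diagonal `B` this entry reads `T rot 0 i * B i i = B 0 0 * T rot 0 i`.
    have h1 := congrFun (congrFun (h rot) 0) i
    rw [Matrix.mul_apply, Matrix.mul_apply, Finset.sum_eq_single i, Finset.sum_eq_single 0,
      mul_comm] at h1
    · simpa using mul_right_cancel₀ (T_rot_ne_zero p i) h1
    · intro b _ hb
      rw [hd 0 b hb.symm, zero_mul]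
    · simp
    · intro b _ hb
      rw [hd b i hb, mul_zero]
    · simp
  · rw [hd i j hij]
    simp [hij]

/-! ### Haar measure on `SU(2)` -/

instance : IsTopologicalGroup K where
  continuous_inv := by
    refine Continuous.subtype_mk ?_ _
    exact continuous_star.comp continuous_subtype_val

theorem isCompact_specialUnitaryGroup :
    IsCompact (Matrix.specialUnitaryGroup (Fin 2) ℂ : Set (Matrix (Fin 2) (Fin 2) ℂ)) := by
  have hb : IsCompact (Set.univ.pi fun _ : Fin 2 => Set.univ.pi fun _ : Fin 2 =>
      Metric.closedBall (0 : ℂ) 1) :=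
    isCompact_univ_pi fun _ => isCompact_univ_pi fun _ => isCompact_closedBall _ _
  have hs : IsClosed
      (Matrix.specialUnitaryGroup (Fin 2) ℂ : Set (Matrix (Fin 2) (Fin 2) ℂ)) := by
    have : (Matrix.specialUnitaryGroup (Fin 2) ℂ : Set (Matrix (Fin 2) (Fin 2) ℂ)) =
        {g | g * star g = 1} ∩ {g | g.det = 1} := by
      ext g
      simp only [SetLike.mem_coe, Matrix.mem_specialUnitaryGroup_iff,
        Matrix.mem_unitaryGroup_iff]
      rfl
    rw [this]
    exact (isClosed_eq (continuous_id.mul continuous_star) continuous_const).inter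
      (isClosed_eq continuous_id.matrix_det continuous_const)
  refine hb.of_isClosed_subset hs fun g hg => ?_
  simp only [Set.mem_pi, Set.mem_univ, true_implies, mem_closedBall_zero_iff]
  exact fun i j => entry_norm_bound_of_unitary
    (Matrix.mem_specialUnitaryGroup_iff.mp hg).1 i j

instance : CompactSpace K := isCompact_iff_compactSpace.mp isCompact_specialUnitaryGroup

instance : MeasurableSpace K := borel K

instance : BorelSpace K := ⟨rfl⟩

/-- The normalized Haar measure on `SU(2)`. -/
def haarK : Measure K := Measure.haarMeasure ⊤

instance : IsProbabilityMeasure haarK :=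
  ⟨Measure.haarMeasure_self (G := K) (K₀ := ⊤)⟩

instance : Measure.IsMulLeftInvariant haarK := by unfold haarK; infer_instance

theorem integrable_haarK {f : K → ℂ} (hf : Continuous f) : Integrable f haarK :=
  hf.integrable_of_hasCompactSupport (HasCompactSupport.of_compactSpace f)

/-! ### Averaging over `SU(2)` and Schur orthogonality -/

/-- A continuous unitary matrix representation of `SU(2)`. -/
structure IsUnitaryRep {ι : Type*} [Fintype ι] [DecidableEq ι] (π : K → Matrix ι ι ℂ) : Prop where
  continuous : Continuous π
  map_mul : ∀ g h, π (g * h) = π g * π h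
  unitary : ∀ g, (π g)ᴴ * π g = 1

theorem isUnitaryRep_T (L : ℕ) : IsUnitaryRep (T L) :=
  ⟨continuous_T L, T_mul L, conjTranspose_T_mul L⟩

theorem continuous_T₂ (p q : ℕ) : Continuous (T₂ p q) := by
  refine continuous_matrix fun i j => ?_
  exact (((continuous_T p).comp continuous_fst).matrix_elem i.1 j.1).mul
    (((continuous_T q).comp continuous_snd).matrix_elem i.2 j.2)

theorem T₂_mul (p q : ℕ) (x y : U) : T₂ p q (x * y) = T₂ p q x * T₂ p q y := by
  simp [T₂, T_mul, Matrix.mul_kronecker_mul]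

theorem T₂_inv (p q : ℕ) (x : U) : T₂ p q x⁻¹ = (T₂ p q x)ᴴ := by
  simp [T₂, T_inv, Matrix.conjTranspose_kronecker]

theorem T₂_one (p q : ℕ) : T₂ p q 1 = 1 := by
  simp [T₂, T_one]

theorem isUnitaryRep_T₂ (p q : ℕ) : IsUnitaryRep fun k => T₂ p q (k, k) where
  continuous := (continuous_T₂ p q).comp (continuous_id.prodMk continuous_id)
  map_mul g h := T₂_mul p q (g, g) (h, h)
  unitary g := by rw [← T₂_inv, ← T₂_mul, inv_mul_cancel, T₂_one]

theorem mul_mul_apply {ι ι' κ κ' : Type*} [Fintype ι] [Fintype κ]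
    (X : Matrix ι' ι ℂ) (P : Matrix ι κ ℂ) (Y : Matrix κ κ' ℂ) (i : ι') (j : κ') :
    (X * P * Y) i j = ∑ l, ∑ l', X i l' * P l' l * Y l j := by
  simp_rw [Matrix.mul_apply, Finset.sum_mul]

section Average

variable {ι κ : Type*} [Fintype ι] [DecidableEq ι] [Fintype κ] [DecidableEq κ]

/-- The average of `π₁(k) Z π₂(k)*` over `SU(2)`. -/
def average (π₁ : K → Matrix ι ι ℂ) (π₂ : K → Matrix κ κ ℂ) (Z : Matrix ι κ ℂ) : Matrix ι κ ℂ :=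
  Matrix.of fun i j => ∫ k, (π₁ k * Z * (π₂ k)ᴴ) i j ∂haarK

/-- Left invariance of Haar measure absorbs the substitution `k ↦ g k`. -/
theorem average_intertwines {π₁ : K → Matrix ι ι ℂ} {π₂ : K → Matrix κ κ ℂ}
    (h₁ : IsUnitaryRep π₁) (h₂ : IsUnitaryRep π₂) (Z : Matrix ι κ ℂ) (g : K) :
    π₁ g * average π₁ π₂ Z = average π₁ π₂ Z * π₂ g := by
  have hc : ∀ i j, Continuous fun k => (π₁ k * Z * (π₂ k)ᴴ) i j := fun i j =>
    ((h₁.continuous.matrix_mul continuous_const).matrix_mul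
      h₂.continuous.matrix_conjTranspose).matrix_elem i j
  have key : π₁ g * average π₁ π₂ Z * (π₂ g)ᴴ = average π₁ π₂ Z := by
    ext i j
    have e1 : (π₁ g * average π₁ π₂ Z * (π₂ g)ᴴ) i j =
        ∫ k, (π₁ g * (π₁ k * Z * (π₂ k)ᴴ) * (π₂ g)ᴴ) i j ∂haarK := by
      simp only [mul_mul_apply (π₁ g) _ (π₂ g)ᴴ]
      rw [integral_finsetSum]
      · refine Finset.sum_congr rfl fun l _ => ?_
        rw [integral_finsetSum]
        · refine Finset.sum_congr rfl fun l' _ => ?_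
          rw [integral_mul_const, integral_const_mul]
          rfl
        · exact fun l' _ => ((integrable_haarK (hc l' l)).const_mul _).mul_const _
      · exact fun l _ => integrable_finsetSum _
          fun l' _ => ((integrable_haarK (hc l' l)).const_mul _).mul_const _
    rw [e1, average, Matrix.of_apply,
      ← integral_mul_left_eq_self (fun k => (π₁ k * Z * (π₂ k)ᴴ) i j) g]
    congr 1
    ext k
    rw [h₁.map_mul, h₂.map_mul, Matrix.conjTranspose_mul]
    simp only [Matrix.mul_assoc]
  calc π₁ g * average π₁ π₂ Z = π₁ g * average π₁ π₂ Z * ((π₂ g)ᴴ * π₂ g) := by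
        rw [h₂.unitary, Matrix.mul_one]
    _ = average π₁ π₂ Z * π₂ g := by rw [← Matrix.mul_assoc, key]

/-- Integrals of products of matrix coefficients are entries of intertwiners, so Schur's lemma
evaluates them. -/
theorem average_single (π₁ : K → Matrix ι ι ℂ) (π₂ : K → Matrix κ κ ℂ) (i i' : ι) (j j' : κ) :
    average π₁ π₂ (Matrix.single i' j' 1) i j = ∫ k, π₁ k i i' * star (π₂ k j j') ∂haarK := by
  rw [average, Matrix.of_apply]
  congr 1
  ext k
  rw [mul_mul_apply, Finset.sum_eq_single j', Finset.sum_eq_single i']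
  · simp
  · intro b _ hb
    simp [hb.symm]
  · simp
  · intro b _ hb
    simp [hb.symm]
  · simp

end Average

/-- Schur orthogonality for inequivalent representations. -/
theorem schur_orthogonality_of_ne {p q : ℕ} (hpq : p ≠ q) (i i' : Fin (p + 1))
    (j j' : Fin (q + 1)) : ∫ k, T p k i i' * star (T q k j j') ∂haarK = 0 := by
  rw [← average_single (T p) (T q), schur_of_ne hpq
    (average_intertwines (isUnitaryRep_T p) (isUnitaryRep_T q) _)]
  rfl

/-- Schur orthogonality. -/
theorem schur_orthogonality_self {p : ℕ} (i i' j j' : Fin (p + 1)) :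
    ∫ k, T p k i i' * star (T p k j j') ∂haarK =
      if i = j ∧ i' = j' then ((p : ℂ) + 1)⁻¹ else 0 := by
  have hB := schur_self (average_intertwines (isUnitaryRep_T p) (isUnitaryRep_T p)
    (Matrix.single i' j' 1))
  set c := average (T p) (T p) (Matrix.single i' j' 1) 0 0 with hc
  have hp : ((p : ℂ) + 1) ≠ 0 := by exact_mod_cast Nat.succ_ne_zero p
  -- The average is the scalar `c`, whose trace is `c (p + 1)`; unitarity of `T p k` computes that
  -- trace under the integral.
  have htr : (average (T p) (T p) (Matrix.single i' j' 1)).trace = if i' = j' then 1 else 0 := by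
    simp only [Matrix.trace, Matrix.diag, average_single]
    rw [← integral_finsetSum]
    · have : ∀ k, ∑ i, T p k i i' * star (T p k i j') = if i' = j' then 1 else 0 := by
        intro k
        have := congrFun (congrFun (conjTranspose_T_mul p k) j') i'
        rw [Matrix.mul_apply, Matrix.one_apply] at this
        simp only [Matrix.conjTranspose_apply] at this
        rw [Finset.sum_congr rfl fun i _ => mul_comm _ _, this]
        simp [eq_comm]
      simp_rw [this]
      simp
    · intro i _
      exact integrable_haarK (((continuous_T p).matrix_elem _ _).mul
        ((continuous_T p).matrix_elem _ _).star)
  rw [hB] at htr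
  simp at htr
  rw [← average_single (T p) (T p), hB, Matrix.smul_apply, Matrix.one_apply, smul_eq_mul]
  by_cases h : i = j
  · by_cases h' : i' = j'
    · simp only [h, h', if_true, and_self, mul_one] at htr ⊢
      exact eq_inv_of_mul_eq_one_left htr
    · simp only [h, h', if_true, if_false, and_false, mul_one] at htr ⊢
      exact (mul_eq_zero.mp htr).resolve_right hp
  · simp [h]

/-! ### Class functions -/

/-- The unitary matrix with first column `(x, y)`. -/
def ofColumn (x y : ℂ) (h : x * star x + y * star y = 1) : K :=
  ⟨!![x, -star y; y, star x], by
    rw [Matrix.mem_specialUnitaryGroup_iff, Matrix.mem_unitaryGroup_iff']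
    have h' : star x * x + star y * y = 1 := by linear_combination h
    constructor
    · ext i j
      fin_cases i <;> fin_cases j <;>
        simp [Matrix.mul_apply, Matrix.star_apply] at h h' ⊢
      · exact h'
      · ring
      · ring
      · linear_combination h
    · simp [Matrix.det_fin_two] at h h' ⊢
      linear_combination h⟩

theorem exists_unit_eigenvector (g : Matrix (Fin 2) (Fin 2) ℂ) :
    ∃ (μ x y : ℂ), x * star x + y * star y = 1 ∧ g 0 0 * x + g 0 1 * y = μ * x ∧
      g 1 0 * x + g 1 1 * y = μ * y := by
  obtain ⟨μ, hμ⟩ := Module.End.exists_eigenvalue (Matrix.toLin' g)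
  obtain ⟨v, hv⟩ := hμ.exists_hasEigenvector
  have hv1 := hv.apply_eq_smul
  have hv0 := hv.2
  rw [Matrix.toLin'_apply] at hv1
  have e0 := congrFun hv1 0
  have e1 := congrFun hv1 1
  simp [Matrix.mulVec, dotProduct, Fin.sum_univ_two] at e0 e1
  set r : ℝ := Complex.normSq (v 0) + Complex.normSq (v 1) with hr
  have hr0 : 0 < r := by
    by_contra hle
    have h0 := Complex.normSq_nonneg (v 0)
    have h1 := Complex.normSq_nonneg (v 1)
    apply hv0
    have z0 : v 0 = 0 := Complex.normSq_eq_zero.mp (by linarith)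
    have z1 : v 1 = 0 := Complex.normSq_eq_zero.mp (by linarith)
    ext l
    fin_cases l
    · exact z0
    · exact z1
  have hs : ((Real.sqrt r : ℝ) : ℂ) ≠ 0 := by
    rw [Complex.ofReal_ne_zero]; positivity
  have hss : ((Real.sqrt r : ℝ) : ℂ) * ((Real.sqrt r : ℝ) : ℂ) = r := by
    rw [← Complex.ofReal_mul, Real.mul_self_sqrt hr0.le]
  refine ⟨μ, v 0 / (Real.sqrt r : ℝ), v 1 / (Real.sqrt r : ℝ), ?_, ?_, ?_⟩
  · have hrc : (r : ℂ) = v 0 * star (v 0) + v 1 * star (v 1) := by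
      rw [hr]
      push_cast
      rw [← Complex.mul_conj, ← Complex.mul_conj]
      rfl
    simp only [star_div₀, RCLike.star_def, Complex.conj_ofReal] at hrc ⊢
    rw [div_mul_div_comm, div_mul_div_comm, hss, ← add_div, ← hrc, div_self]
    rw [Complex.ofReal_ne_zero]
    exact hr0.ne'
  · field_simp
    linear_combination e0
  · field_simp
    linear_combination e1

theorem eq_m_of_apply_one_zero {k : K} (hk : (k : Matrix (Fin 2) (Fin 2) ℂ) 1 0 = 0) :
    ∃ s, k = m s := by
  obtain ⟨hu, hdet⟩ := Matrix.mem_specialUnitaryGroup_iff.mp k.2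
  have h1 := congrFun (congrFun (Matrix.mem_unitaryGroup_iff'.mp hu) 0) 0
  have h2 := congrFun (congrFun (Matrix.mem_unitaryGroup_iff'.mp hu) 0) 1
  simp [Matrix.mul_apply, Matrix.star_apply, Fin.sum_univ_two, hk] at h1 h2
  rw [Matrix.det_fin_two, hk] at hdet
  have hx : (k : Matrix (Fin 2) (Fin 2) ℂ) 0 0 ≠ 0 := by
    intro h0
    simp [h0] at h1
  have h01 : (k : Matrix (Fin 2) (Fin 2) ℂ) 0 1 = 0 := h2.resolve_left hx
  have hn : ‖(k : Matrix (Fin 2) (Fin 2) ℂ) 0 0‖ = 1 := by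
    have : (Complex.normSq ((k : Matrix (Fin 2) (Fin 2) ℂ) 0 0) : ℂ) = 1 := by
      rw [← Complex.mul_conj, mul_comm]; exact h1
    rw [Complex.normSq_eq_norm_sq] at this
    have h' : ‖(k : Matrix (Fin 2) (Fin 2) ℂ) 0 0‖ ^ 2 = 1 := by exact_mod_cast this
    nlinarith [norm_nonneg ((k : Matrix (Fin 2) (Fin 2) ℂ) 0 0)]
  obtain ⟨θ, hθ⟩ := (Complex.norm_eq_one_iff _).mp hn
  have e1 : Complex.exp (Complex.I * ((2 * θ : ℝ) : ℂ) / 2) =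
      (k : Matrix (Fin 2) (Fin 2) ℂ) 0 0 := by
    rw [← hθ]
    congr 1
    push_cast
    ring
  -- The factor 2 compensates the half angle in `m`.
  refine ⟨2 * θ, Subtype.ext ?_⟩
  ext i j
  fin_cases i <;> fin_cases j
  · simpa [m] using e1.symm
  · simpa [m] using h01
  · simpa [m] using hk
  · simp only [m, Complex.exp_neg, e1]
    simp
    rw [← mul_eq_one_iff_eq_inv₀ hx]
    linear_combination hdet

/-- Every element of `SU(2)` is conjugate to an element of the maximal torus. -/
theorem exists_conj_m (k : K) : ∃ (g : K) (s : ℝ), k = g * m s * g⁻¹ := by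
  obtain ⟨μ, x, y, hn, h0, h1⟩ := exists_unit_eigenvector (k : Matrix (Fin 2) (Fin 2) ℂ)
  -- The first column of the conjugating matrix is an eigenvector of `k`, which makes the conjugate
  -- upper triangular, hence diagonal by unitarity.
  have hk : ((((ofColumn x y hn)⁻¹ * k * ofColumn x y hn : K)) : Matrix (Fin 2) (Fin 2) ℂ) 1 0
      = 0 := by
    change (star (ofColumn x y hn).1 * k.1 * (ofColumn x y hn).1) 1 0 = 0
    simp [ofColumn, Matrix.mul_apply, Fin.sum_univ_two, Matrix.star_apply]
    linear_combination (-y) * h0 + x * h1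
  obtain ⟨s, hs⟩ := eq_m_of_apply_one_zero hk
  refine ⟨ofColumn x y hn, s, ?_⟩
  rw [← hs]
  group

/-- Functions on `SU(2)` that are constant on conjugacy classes. -/
def IsClassFunction (F : K → ℂ) : Prop := ∀ g k, F (g * k * g⁻¹) = F k

theorem IsClassFunction.ext {F G : K → ℂ} (hF : IsClassFunction F) (hG : IsClassFunction G)
    (h : ∀ s, F (m s) = G (m s)) : F = G := by
  ext k
  obtain ⟨g, s, rfl⟩ := exists_conj_m k
  rw [hF, hG, h]

/-- Conjugation by the nontrivial Weyl group element, represented by `ofColumn 0 1`, inverts the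
torus. -/
theorem IsClassFunction.m_neg {F : K → ℂ} (hF : IsClassFunction F) (s : ℝ) :
    F (m (-s)) = F (m s) := by
  rw [← hF (ofColumn 0 1 (by simp)) (m s)]
  congr 1
  rw [eq_mul_inv_iff_mul_eq]
  apply Subtype.ext
  change (m (-s)).1 * (ofColumn 0 1 _).1 = (ofColumn 0 1 _).1 * (m s).1
  ext i j
  fin_cases i <;> fin_cases j <;> simp [m, ofColumn, Matrix.mul_apply, Fin.sum_univ_two, neg_div]

/-- The character of `T^ℓ`. -/
def chi (n : ℕ) (k : K) : ℂ := (T n k).trace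

theorem isClassFunction_chi (n : ℕ) : IsClassFunction (chi n) := by
  intro g k
  rw [chi, T_mul, T_mul, Matrix.trace_mul_cycle, ← T_mul, inv_mul_cancel, T_one, Matrix.one_mul]
  rfl

theorem continuous_chi (n : ℕ) : Continuous (chi n) := (continuous_T n).matrix_trace

theorem chi_m (n : ℕ) (s : ℝ) : chi n (m s) =
    ∑ j ∈ Finset.range (n + 1), Complex.exp (((n : ℂ) - 2 * j) * (s / 2) * Complex.I) := by
  rw [chi, T_m, Matrix.trace_diagonal,
    Finset.sum_range fun j => Complex.exp (((n : ℂ) - 2 * j) * (s / 2) * Complex.I)]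

theorem chi_zero (k : K) : chi 0 k = 1 := by
  have h := T_zero_apply 0 k 0
  rw [chi, Matrix.trace_fin_one, h]
  simp [ev]

/-- The Clebsch–Gordan rule in recursive form. On the torus it follows by splitting the exponential
sums for the three characters, which avoids dividing by a Weyl denominator. -/
theorem chi_succ_mul_chi_succ (p q : ℕ) (k : K) :
    chi (p + 1) k * chi (q + 1) k = chi p k * chi q k + chi (p + q + 2) k := by
  have hc : ∀ n g k, chi n (g * k * g⁻¹) = chi n k := fun n => isClassFunction_chi n
  refine congrFun (IsClassFunction.ext (F := fun k => chi (p + 1) k * chi (q + 1) k)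
    (G := fun k => chi p k * chi q k + chi (p + q + 2) k) (fun g k => by simp only [hc])
    (fun g k => by simp only [hc]) fun s => ?_) k
  set e : ℂ → ℂ := fun x => Complex.exp (x * (s / 2) * Complex.I) with he
  have hadd : ∀ x y, e x * e y = e (x + y) := by
    intro x y
    rw [he]
    simp only
    rw [← Complex.exp_add]
    ring_nf
  have hchi : ∀ n : ℕ, chi n (m s) = ∑ j ∈ Finset.range (n + 1), e ((n : ℂ) - 2 * j) :=
    fun n => chi_m n s
  have h1 : chi (p + q + 2) (m s) =
      e (p + 1) * chi (q + 1) (m s) + (e (-1) * chi p (m s)) * e (-(q + 1)) := by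
    rw [hchi, hchi, hchi, show p + q + 2 + 1 = (q + 1 + 1) + (p + 1) by ring,
      Finset.sum_range_add, Finset.mul_sum, Finset.mul_sum, Finset.sum_mul]
    congr 1 <;> refine Finset.sum_congr rfl fun j _ => ?_
    · rw [hadd]; congr 1; push_cast; ring
    · rw [hadd, hadd]; congr 1; push_cast; ring
  have h2 : chi (p + 1) (m s) = e (p + 1) + e (-1) * chi p (m s) := by
    rw [hchi, hchi, Finset.sum_range_succ', add_comm, Finset.mul_sum]
    congr 1
    · congr 1; push_cast; ring
    · refine Finset.sum_congr rfl fun j _ => ?_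
      rw [hadd]; congr 1; push_cast; ring
  have h3 : chi (q + 1) (m s) = e 1 * chi q (m s) + e (-(q + 1)) := by
    rw [hchi, hchi, Finset.sum_range_succ, Finset.mul_sum]
    congr 1
    · refine Finset.sum_congr rfl fun j _ => ?_
      rw [hadd]; congr 1; push_cast; ring
    · congr 1; push_cast; ring
  have h4 : e (-1) * e 1 = 1 := by rw [hadd]; simp [he]
  rw [h1, h2]
  linear_combination (e (-1) * chi p (m s)) * h3 + chi p (m s) * chi q (m s) * h4

theorem integral_chi_mul_star_chi (p q : ℕ) :
    ∫ k, chi p k * star (chi q k) ∂haarK = if p = q then 1 else 0 := by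
  have e : ∀ k, chi p k * star (chi q k) = ∑ i, ∑ j, T p k i i * star (T q k j j) := by
    intro k
    simp only [chi, Matrix.trace, Matrix.diag, star_sum, Finset.sum_mul_sum]
  have hi : ∀ i j, Integrable (fun k => T p k i i * star (T q k j j)) haarK := fun i j =>
    integrable_haarK (((continuous_T p).matrix_elem _ _).mul
      ((continuous_T q).matrix_elem _ _).star)
  simp_rw [e]
  rw [integral_finsetSum _ fun i _ => integrable_finsetSum _ fun j _ => hi i j]
  simp_rw [integral_finsetSum _ fun j _ => hi _ j]
  by_cases hpq : p = q
  · subst hpq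
    simp_rw [schur_orthogonality_self]
    have hp : ((p : ℂ) + 1) ≠ 0 := by exact_mod_cast Nat.succ_ne_zero p
    simp [hp]
  · simp_rw [schur_orthogonality_of_ne hpq]
    simp [hpq]

theorem integral_chi (n : ℕ) : ∫ k, chi n k ∂haarK = if n = 0 then 1 else 0 := by
  rw [← integral_chi_mul_star_chi n 0]
  simp [chi_zero]

/-! ### The Weyl integration formula -/

/-- The class function with value `cos (n t)` at `m_{2t}`. -/
def cosK : ℕ → K → ℂ
  | 0 => fun _ => 1
  | 1 => fun k => chi 1 k / 2
  | n + 2 => fun k => (chi (n + 2) k - chi n k) / 2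

theorem isClassFunction_cosK (n : ℕ) : IsClassFunction (cosK n) := by
  have hc : ∀ n g k, chi n (g * k * g⁻¹) = chi n k := fun n => isClassFunction_chi n
  intro g k
  match n with
  | 0 => rfl
  | 1 => simp only [cosK, hc]
  | n + 2 => simp only [cosK, hc]

theorem continuous_cosK (n : ℕ) : Continuous (cosK n) := by
  match n with
  | 0 => exact continuous_const
  | 1 => exact (continuous_chi 1).div_const 2
  | n + 2 => exact ((continuous_chi (n + 2)).sub (continuous_chi n)).div_const 2

/-- The weights of `χ_n` are those of `χ_{n-2}` together with `±n`, so the difference leaves the two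
extreme exponentials. -/
theorem cosK_m (n : ℕ) (t : ℝ) : cosK n (m (2 * t)) = Complex.cos (n * t) := by
  match n with
  | 0 => simp [cosK]
  | 1 =>
    simp only [cosK]
    rw [chi_m, Complex.cos, Finset.sum_range_succ, Finset.sum_range_one]
    congr 2 <;> congr 1 <;> push_cast <;> ring
  | n + 2 =>
    simp only [cosK]
    rw [chi_m, chi_m, Complex.cos, Finset.sum_range_succ' _ (n + 2), Finset.sum_range_succ _ (n + 1)]
    have hj : ∀ j : ℕ, Complex.exp ((((n + 2 : ℕ) : ℂ) - 2 * ((j + 1 : ℕ) : ℂ)) *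
        (((2 * t : ℝ) : ℂ) / 2) * Complex.I) =
        Complex.exp (((n : ℂ) - 2 * (j : ℂ)) * (((2 * t : ℝ) : ℂ) / 2) * Complex.I) := by
      intro j; congr 1; push_cast; ring
    have e1 : (((n + 2 : ℕ) : ℂ) - 2 * ((0 : ℕ) : ℂ)) * (((2 * t : ℝ) : ℂ) / 2) * Complex.I =
      ((n + 2 : ℕ) : ℂ) * t * Complex.I := by push_cast; ring
    have e2 : (((n + 2 : ℕ) : ℂ) - 2 * ((n + 1 + 1 : ℕ) : ℂ)) * (((2 * t : ℝ) : ℂ) / 2) * Complex.I =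
      -(((n + 2 : ℕ) : ℂ) * t) * Complex.I := by push_cast; ring
    rw [e1, e2, Finset.sum_congr rfl fun j _ => hj j]
    ring

theorem integral_cosK (n : ℕ) :
    ∫ k, cosK n k ∂haarK = if n = 0 then 1 else if n = 2 then -1 / 2 else 0 := by
  match n with
  | 0 => simp [cosK]
  | 1 => simp [cosK, integral_div, integral_chi]
  | n + 2 =>
    simp only [cosK]
    rw [integral_div, integral_sub (integrable_haarK (continuous_chi _))
      (integrable_haarK (continuous_chi _)), integral_chi, integral_chi]
    by_cases h : n = 0
    · simp [h]
    · simp [h]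

theorem integral_cos_int_mul (n : ℤ) :
    ∫ t in (0 : ℝ)..4 * Real.pi, Real.cos (n * t) = if n = 0 then 4 * Real.pi else 0 := by
  by_cases h : n = 0
  · simp [h]
  · have hn : (n : ℝ) ≠ 0 := by exact_mod_cast h
    rw [intervalIntegral.integral_comp_mul_left (fun t => Real.cos t) hn, integral_cos, if_neg h]
    have : (n : ℝ) * (4 * Real.pi) = ((4 * n : ℤ) : ℝ) * Real.pi := by push_cast; ring
    rw [this, Real.sin_int_mul_pi]
    simp

/-- Up to the factor `2π` these are the values in `integral_cosK`; this agreement is the content of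
the Weyl formula here. -/
theorem integral_sin_sq_mul_cos (n : ℕ) :
    ∫ t in (0 : ℝ)..4 * Real.pi, Real.sin t ^ 2 * Real.cos (n * t) =
      2 * Real.pi * if n = 0 then 1 else if n = 2 then -1 / 2 else 0 := by
  have e : ∀ t : ℝ, Real.sin t ^ 2 * Real.cos (n * t) =
      Real.cos ((n : ℤ) * t) / 2 - Real.cos (((n + 2 : ℤ) : ℝ) * t) / 4 -
        Real.cos (((n - 2 : ℤ) : ℝ) * t) / 4 := by
    intro t
    have h1 : ((n + 2 : ℤ) : ℝ) * t = n * t + 2 * t := by push_cast; ring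
    have h2 : ((n - 2 : ℤ) : ℝ) * t = n * t - 2 * t := by push_cast; ring
    rw [h1, h2, Real.cos_add, Real.cos_sub, Real.cos_two_mul, Real.cos_sq']
    push_cast
    ring
  have hi : ∀ (n : ℤ) (c : ℝ), IntervalIntegrable (fun t : ℝ => Real.cos (n * t) / c) volume 0
      (4 * Real.pi) := fun n c => by
    apply Continuous.intervalIntegrable
    fun_prop
  simp_rw [e]
  rw [intervalIntegral.integral_sub ((hi _ _).sub (hi _ _)) (hi _ _),
    intervalIntegral.integral_sub (hi _ _) (hi _ _), intervalIntegral.integral_div,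
    intervalIntegral.integral_div, intervalIntegral.integral_div, integral_cos_int_mul,
    integral_cos_int_mul, integral_cos_int_mul]
  have h3 : ((n : ℤ) + 2 = 0) = False := by
    simp only [eq_iff_iff, iff_false]; omega
  have h4 : ((n : ℤ) - 2 = 0) = (n = 2) := by
    simp only [eq_iff_iff]; omega
  have h5 : ((n : ℤ) = 0) = (n = 0) := by simp
  simp only [h3, h4, h5]
  rcases eq_or_ne n 0 with h | h
  · subst h; simp; ring
  · rcases eq_or_ne n 2 with h' | h'
    · subst h'; simp; ring
    · simp [h, h']

/-- The Weyl integration formula, for class functions given by a trigonometric polynomial. -/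
theorem weyl_integration {σ : Type*} [Fintype σ] {F : K → ℂ} (hF : IsClassFunction F) (w : σ → ℂ)
    (n : σ → ℤ) (h : ∀ t : ℝ, F (m (2 * t)) = ∑ x, w x * Complex.exp (n x * t * Complex.I)) :
    ∫ t in (0 : ℝ)..4 * Real.pi, ((Real.sin t ^ 2 : ℝ) : ℂ) * F (m (2 * t)) =
      2 * Real.pi * ∫ k, F k ∂haarK := by
  -- Weyl invariance makes `F (m (2 * t))` even in `t`, so averaging over `±t` replaces exponentials
  -- by cosines.
  have hcos : ∀ t : ℝ, F (m (2 * t)) = ∑ x, w x * ((Real.cos ((n x).natAbs * t) : ℝ) : ℂ) := by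
    intro t
    have h1 : F (m (2 * t)) = (F (m (2 * t)) + F (m (2 * (-t)))) / 2 := by
      rw [mul_neg, hF.m_neg]; ring
    rw [h1, h, h, ← Finset.sum_add_distrib, Finset.sum_div]
    refine Finset.sum_congr rfl fun x _ => ?_
    have h2 : Real.cos ((n x).natAbs * t) = Real.cos (n x * t) := by
      rcases Int.natAbs_eq (n x) with hx | hx
      · conv_rhs => rw [hx]
        simp
      · conv_rhs => rw [hx]
        simp
    rw [h2, Complex.ofReal_cos, Complex.cos]
    push_cast
    ring_nf
  have hFk : F = fun k => ∑ x, w x * cosK (n x).natAbs k := by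
    refine hF.ext (fun g k => ?_) fun s => ?_
    · simp only [fun n => isClassFunction_cosK n g k]
    · obtain ⟨t, rfl⟩ : ∃ t, s = 2 * t := ⟨s / 2, by ring⟩
      rw [hcos]
      simp_rw [cosK_m]
      push_cast
      rfl
  have hi : ∀ x, Integrable (fun k => w x * cosK (n x).natAbs k) haarK := fun x =>
    (integrable_haarK (continuous_cosK _)).const_mul _
  conv_rhs => rw [hFk]
  simp_rw [hcos, Finset.mul_sum]
  rw [intervalIntegral.integral_finsetSum, integral_finsetSum _ fun x _ => hi x, Finset.mul_sum]
  · refine Finset.sum_congr rfl fun x _ => ?_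
    rw [integral_const_mul, integral_cosK]
    have : ∀ t : ℝ, ((Real.sin t ^ 2 : ℝ) : ℂ) * (w x * ((Real.cos ((n x).natAbs * t) : ℝ) : ℂ)) =
        w x * ((Real.sin t ^ 2 * Real.cos ((n x).natAbs * t) : ℝ) : ℂ) := by
      intro t; push_cast; ring
    simp_rw [this]
    rw [intervalIntegral.integral_const_mul, intervalIntegral.integral_ofReal,
      integral_sin_sq_mul_cos]
    split_ifs <;> push_cast <;> ring
  · intro x _
    apply Continuous.intervalIntegrable
    fun_prop

/-! ### Existence of the isometric intertwiners -/

/-- The integral of `χ_p χ_q conj(χ_r)`. -/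
def tripleInt (p q r : ℕ) : ℂ := ∫ k, chi p k * chi q k * star (chi r k) ∂haarK

theorem tripleInt_zero_left (q r : ℕ) : tripleInt 0 q r = if q = r then 1 else 0 := by
  simp [tripleInt, chi_zero, ← integral_chi_mul_star_chi]

theorem tripleInt_zero_right (p r : ℕ) : tripleInt p 0 r = if p = r then 1 else 0 := by
  simp [tripleInt, chi_zero, ← integral_chi_mul_star_chi]

theorem tripleInt_succ_succ (p q r : ℕ) :
    tripleInt (p + 1) (q + 1) r = tripleInt p q r + if p + q + 2 = r then 1 else 0 := by
  rw [tripleInt, tripleInt, ← integral_chi_mul_star_chi, ← integral_add]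
  · congr 1
    ext k
    rw [chi_succ_mul_chi_succ, add_mul]
  · exact integrable_haarK (((continuous_chi p).mul (continuous_chi q)).mul (continuous_chi r).star)
  · exact integrable_haarK ((continuous_chi _).mul (continuous_chi r).star)

theorem tripleInt_of_lt {p q r : ℕ} (h : p + q < r) : tripleInt p q r = 0 := by
  induction p generalizing q with
  | zero => rw [tripleInt_zero_left, if_neg (by omega)]
  | succ p ih =>
    cases q with
    | zero => rw [tripleInt_zero_right, if_neg (by omega)]
    | succ q => rw [tripleInt_succ_succ, ih (by omega), if_neg (by omega), add_zero]

/-- Lowering both indices of the product removes only the top constituent. For `d > 0` that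
constituent is not `p + q`; for `d = 0` it is, and supplies the value 1. -/
theorem tripleInt_add (d p q : ℕ) : tripleInt (d + p) (d + q) (p + q) = 1 := by
  induction d with
  | zero =>
    rw [zero_add, zero_add]
    cases p with
    | zero => rw [tripleInt_zero_left, if_pos (by omega)]
    | succ p =>
      cases q with
      | zero => rw [tripleInt_zero_right, if_pos (by omega)]
      | succ q => rw [tripleInt_succ_succ, tripleInt_of_lt (by omega), if_pos (by omega), zero_add]
  | succ d ih =>
    rw [show d + 1 + p = d + p + 1 by ring, show d + 1 + q = d + q + 1 by ring,
      tripleInt_succ_succ, ih, if_neg (by omega), add_zero]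

theorem conjTranspose_mul_self_apply {ι κ : Type*} [Fintype ι] (B : Matrix ι κ ℂ) (j : κ) :
    (Bᴴ * B) j j = ((∑ i, ‖B i j‖ ^ 2 : ℝ) : ℂ) := by
  rw [Matrix.mul_apply]
  push_cast
  refine Finset.sum_congr rfl fun i _ => ?_
  rw [Matrix.conjTranspose_apply, RCLike.star_def, RCLike.conj_mul]
  rfl

theorem conjTranspose_mul_T₂ {p q r : ℕ}
    {B : Matrix (Fin (p + 1) × Fin (q + 1)) (Fin (r + 1)) ℂ}
    (h : ∀ k : K, T₂ p q (k, k) * B = B * T r k) (k : K) :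
    Bᴴ * T₂ p q (k, k) = T r k * Bᴴ := by
  have := congrArg Matrix.conjTranspose (h k⁻¹)
  rw [Matrix.conjTranspose_mul, Matrix.conjTranspose_mul, ← T_inv, inv_inv, ← T₂_inv,
    Prod.inv_mk, inv_inv] at this
  exact this

/-- For an intertwiner `B`, the operator `B* B` is a scalar. -/
theorem conjTranspose_mul_self_eq_smul {p q r : ℕ}
    {B : Matrix (Fin (p + 1) × Fin (q + 1)) (Fin (r + 1)) ℂ}
    (h : ∀ k : K, T₂ p q (k, k) * B = B * T r k) :
    Bᴴ * B = ((∑ i, ‖B i 0‖ ^ 2 : ℝ) : ℂ) • 1 := by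
  rw [← conjTranspose_mul_self_apply]
  refine schur_self fun k => ?_
  rw [← Matrix.mul_assoc, ← conjTranspose_mul_T₂ h, Matrix.mul_assoc, h, Matrix.mul_assoc]

/-- If every intertwiner vanished, so would the averages of all matrix units, and the triple
integral is a sum of their entries. -/
theorem exists_intertwiner_ne_zero {p q r : ℕ} (h : tripleInt p q r ≠ 0) :
    ∃ B : Matrix (Fin (p + 1) × Fin (q + 1)) (Fin (r + 1)) ℂ,
      B ≠ 0 ∧ ∀ k : K, T₂ p q (k, k) * B = B * T r k := by
  by_contra hcon
  push Not at hcon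
  apply h
  have h0 : ∀ I J, ∫ k, T₂ p q (k, k) I I * star (T r k J J) ∂haarK = 0 := by
    intro I J
    rw [← average_single (fun k => T₂ p q (k, k)) (T r)]
    by_contra hne
    obtain ⟨k, hk⟩ := hcon (average (fun k => T₂ p q (k, k)) (T r) (Matrix.single I J 1))
      (fun h => hne (by rw [h]; rfl))
    exact hk (average_intertwines (isUnitaryRep_T₂ p q) (isUnitaryRep_T r) _ k)
  have hi : ∀ I J, Integrable (fun k => T₂ p q (k, k) I I * star (T r k J J)) haarK := fun I J =>
    integrable_haarK (((isUnitaryRep_T₂ p q).continuous.matrix_elem _ _).mul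
      ((continuous_T r).matrix_elem _ _).star)
  have e : ∀ k, chi p k * chi q k * star (chi r k) =
      ∑ I, ∑ J, T₂ p q (k, k) I I * star (T r k J J) := by
    intro k
    have : chi p k * chi q k = (T₂ p q (k, k)).trace := (Matrix.trace_kronecker _ _).symm
    rw [this]
    simp only [chi, Matrix.trace, Matrix.diag, star_sum, Finset.sum_mul_sum]
  rw [tripleInt]
  simp_rw [e]
  rw [integral_finsetSum _ fun i _ => integrable_finsetSum _ fun j _ => hi i j]
  simp_rw [integral_finsetSum _ fun j _ => hi _ j, h0]
  simp

/-- By Schur's lemma `B* B` is a scalar, positive when `B ≠ 0`; dividing by its square root makes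
`B` isometric. -/
theorem exists_isIsometricIntertwiner {p q r : ℕ} (h : tripleInt p q r ≠ 0) :
    ∃ β, IsIsometricIntertwiner p q r β := by
  obtain ⟨B, hB, hint⟩ := exists_intertwiner_ne_zero h
  have hs := conjTranspose_mul_self_eq_smul hint
  set c : ℝ := ∑ i, ‖B i 0‖ ^ 2 with hc
  have hc0 : 0 < c := by
    refine lt_of_le_of_ne (Finset.sum_nonneg fun i _ => by positivity) fun h0 => hB ?_
    rw [← h0, Complex.ofReal_zero, zero_smul] at hs
    open ComplexOrder in
    exact Matrix.conjTranspose_mul_self_eq_zero.mp hs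
  have hcs : ((Real.sqrt c : ℝ) : ℂ)⁻¹ * ((Real.sqrt c : ℝ) : ℂ)⁻¹ * c = 1 := by
    rw [← mul_inv, ← Complex.ofReal_mul, Real.mul_self_sqrt hc0.le]
    exact inv_mul_cancel₀ (Complex.ofReal_ne_zero.mpr hc0.ne')
  refine ⟨((Real.sqrt c : ℝ) : ℂ)⁻¹ • B, ?_, fun k => ?_⟩
  · rw [Matrix.conjTranspose_smul, Matrix.smul_mul, Matrix.mul_smul, hs, smul_smul, smul_smul]
    simp only [star_inv₀, RCLike.star_def, Complex.conj_ofReal]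
    rw [hcs, one_smul]
  · rw [Matrix.mul_smul, Matrix.smul_mul, hint]

theorem beta_spec {p q r : ℕ} (h : tripleInt p q r ≠ 0) :
    IsIsometricIntertwiner p q r (beta p q r) := by
  have hex := exists_isIsometricIntertwiner h
  rw [beta, dif_pos hex]
  exact hex.choose_spec

/-- Every label `ζ(d,p)` entering `Phi` is admissible, so the default value `0` of `beta` never
occurs there. -/
theorem beta_spec_add {L d i : ℕ} (hi : i ≤ L) :
    IsIsometricIntertwiner (d + i) (d + (L - i)) L (beta (d + i) (d + (L - i)) L) := by
  refine beta_spec ?_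
  have := tripleInt_add d i (L - i)
  rw [Nat.add_sub_cancel' hi] at this
  rw [this]
  exact one_ne_zero

/-! ### Spherical functions -/

theorem continuous_sph (L p q : ℕ) : Continuous (sph L p q) :=
  (continuous_const.matrix_mul (continuous_T₂ p q)).matrix_mul continuous_const

section Sph

variable {L p q : ℕ} (hβ : IsIsometricIntertwiner p q L (beta p q L))

include hβ

theorem sph_mul_left (k : K) (x : U) : sph L p q ((k, k) * x) = T L k * sph L p q x := by
  simp only [sph, T₂_mul, ← Matrix.mul_assoc]
  rw [conjTranspose_mul_T₂ hβ.intertwines]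

theorem sph_mul_right (k : K) (x : U) : sph L p q (x * (k, k)) = sph L p q x * T L k := by
  simp only [sph, T₂_mul, Matrix.mul_assoc]
  rw [hβ.intertwines]

end Sph

/-- The index set of the basis of `H^{ℓ₁} ⊗ H^{ℓ₂}`. -/
abbrev Idx (p q : ℕ) : Type := Fin (p + 1) × Fin (q + 1)

theorem m_mul_m (s t : ℝ) : m s * m t = m (s + t) := by
  apply Subtype.ext
  change (m s).1 * (m t).1 = (m (s + t)).1
  ext i j
  fin_cases i <;> fin_cases j <;>
    simp [m, Matrix.mul_apply, Fin.sum_univ_two, ← Complex.exp_add] <;> ring_nf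

theorem m_zero : m 0 = 1 := by
  apply Subtype.ext
  change (m 0).1 = 1
  ext i j
  fin_cases i <;> fin_cases j <;> simp [m]

instance : SecondCountableTopology K := by
  have : SecondCountableTopology (Matrix (Fin 2) (Fin 2) ℂ) :=
    inferInstanceAs (SecondCountableTopology (Fin 2 → Fin 2 → ℂ))
  exact TopologicalSpace.Subtype.secondCountableTopology _

/-! ### Schur orthogonality on `U` -/

/-- The normalized Haar measure on `U`. -/
def haarU : Measure U := haarK.prod haarK

instance : IsProbabilityMeasure haarU := by unfold haarU; infer_instance

theorem integrable_haarU {f : U → ℂ} (hf : Continuous f) : Integrable f haarU :=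
  hf.integrable_of_hasCompactSupport (HasCompactSupport.of_compactSpace f)

/-- The function `tr (Φ(x) Φ'(x)*)` on `U`, for two spherical functions. -/
def sphForm (L p q p' q' : ℕ) (x : U) : ℂ := (sph L p q x * (sph L p' q' x)ᴴ).trace

theorem continuous_sphForm (L p q p' q' : ℕ) : Continuous (sphForm L p q p' q') :=
  ((continuous_sph L p q).matrix_mul (continuous_sph L p' q').matrix_conjTranspose).matrix_trace

theorem sph_apply (L p q : ℕ) (x : U) (s u : Fin (L + 1)) :
    sph L p q x s u = ∑ X : Idx p q × Idx p q,
      (star (beta p q L X.1 s) * beta p q L X.2 u) * T₂ p q x X.1 X.2 := by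
  rw [sph, mul_mul_apply, Fintype.sum_prod_type_right (α₁ := Idx p q)]
  refine Finset.sum_congr rfl fun J _ => ?_
  refine Finset.sum_congr rfl fun I _ => ?_
  rw [Matrix.conjTranspose_apply]
  ring

theorem sphForm_eq_sum (L p q p' q' : ℕ) (x : U) :
    sphForm L p q p' q' x = ∑ s, ∑ u, sph L p q x s u * star (sph L p' q' x s u) := by
  simp [sphForm, Matrix.trace, Matrix.mul_apply]

theorem T₂_orthogonality (p q : ℕ)
    (X Y : Idx p q × Idx p q) :
    ∫ x, T₂ p q x X.1 X.2 * star (T₂ p q x Y.1 Y.2) ∂haarU =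
      if X = Y then (((p : ℂ) + 1) * ((q : ℂ) + 1))⁻¹ else 0 := by
  have e : ∀ x : U, T₂ p q x X.1 X.2 * star (T₂ p q x Y.1 Y.2) =
      (T p x.1 X.1.1 X.2.1 * star (T p x.1 Y.1.1 Y.2.1)) *
        (T q x.2 X.1.2 X.2.2 * star (T q x.2 Y.1.2 Y.2.2)) := by
    intro x
    simp only [T₂, Matrix.kroneckerMap_apply, star_mul']
    ring
  simp_rw [e]
  rw [haarU, integral_prod_mul (fun k => T p k X.1.1 X.2.1 * star (T p k Y.1.1 Y.2.1))
    (fun k => T q k X.1.2 X.2.2 * star (T q k Y.1.2 Y.2.2)), schur_orthogonality_self,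
    schur_orthogonality_self]
  obtain ⟨⟨i, j⟩, k, l⟩ := X
  obtain ⟨⟨i', j'⟩, k', l'⟩ := Y
  simp only [Prod.mk.injEq]
  rw [mul_inv, ite_zero_mul_ite_zero]
  congr 1
  simp only [eq_iff_iff]
  tauto

theorem T₂_orthogonality_of_ne {p q p' q' : ℕ} (h : ¬ (p = p' ∧ q = q'))
    (X : Idx p q × Idx p q)
    (Y : Idx p' q' × Idx p' q') :
    ∫ x, T₂ p q x X.1 X.2 * star (T₂ p' q' x Y.1 Y.2) ∂haarU = 0 := by
  have e : ∀ x : U, T₂ p q x X.1 X.2 * star (T₂ p' q' x Y.1 Y.2) =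
      (T p x.1 X.1.1 X.2.1 * star (T p' x.1 Y.1.1 Y.2.1)) *
        (T q x.2 X.1.2 X.2.2 * star (T q' x.2 Y.1.2 Y.2.2)) := by
    intro x
    simp only [T₂, Matrix.kroneckerMap_apply, star_mul']
    ring
  simp_rw [e]
  rw [haarU, integral_prod_mul (fun k => T p k X.1.1 X.2.1 * star (T p' k Y.1.1 Y.2.1))
    (fun k => T q k X.1.2 X.2.2 * star (T q' k Y.1.2 Y.2.2))]
  by_cases hp : p = p'
  · rw [schur_orthogonality_of_ne (p := q) (q := q') (fun hq => h ⟨hp, hq⟩), mul_zero]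
  · rw [schur_orthogonality_of_ne hp, zero_mul]

theorem integral_sph_mul_star (L p q p' q' : ℕ) (s u : Fin (L + 1)) :
    ∫ x, sph L p q x s u * star (sph L p' q' x s u) ∂haarU =
      ∑ X : Idx p q × Idx p q,
      ∑ Y : Idx p' q' × Idx p' q',
      (star (beta p q L X.1 s) * beta p q L X.2 u) *
        star (star (beta p' q' L Y.1 s) * beta p' q' L Y.2 u) *
        ∫ x, T₂ p q x X.1 X.2 * star (T₂ p' q' x Y.1 Y.2) ∂haarU := by
  have hi : ∀ (c : ℂ) (X : Idx p q × Idx p q) (Y : Idx p' q' × Idx p' q'), Integrable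
      (fun x => c * (T₂ p q x X.1 X.2 * star (T₂ p' q' x Y.1 Y.2))) haarU := fun c X Y =>
    (integrable_haarU (((continuous_T₂ p q).matrix_elem _ _).mul
      ((continuous_T₂ p' q').matrix_elem _ _).star)).const_mul c
  have e : ∀ x : U, sph L p q x s u * star (sph L p' q' x s u) =
      ∑ X : Idx p q × Idx p q,
      ∑ Y : Idx p' q' × Idx p' q',
      (star (beta p q L X.1 s) * beta p q L X.2 u) *
        star (star (beta p' q' L Y.1 s) * beta p' q' L Y.2 u) *
        (T₂ p q x X.1 X.2 * star (T₂ p' q' x Y.1 Y.2)) := by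
    intro x
    rw [sph_apply, sph_apply, star_sum, Finset.sum_mul_sum]
    refine Finset.sum_congr rfl fun X _ => Finset.sum_congr rfl fun Y _ => ?_
    rw [star_mul' (star (beta p' q' L Y.1 s) * beta p' q' L Y.2 u)]
    ring
  simp_rw [e]
  rw [integral_finsetSum _ fun X _ => integrable_finsetSum _ fun Y _ => hi _ X Y]
  refine Finset.sum_congr rfl fun X _ => ?_
  rw [integral_finsetSum _ fun Y _ => hi _ X Y]
  exact Finset.sum_congr rfl fun Y _ => integral_const_mul _ _

/-- For equal labels, each of the `(L + 1)²` matrix entries contributes `1 / ((p + 1)(q + 1))`: the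
double sum factors into the squared norms of two columns of `β`, both equal to 1. -/
theorem integral_sphForm_haarU {L p q p' q' : ℕ}
    (hβ : IsIsometricIntertwiner p q L (beta p q L)) :
    ∫ x, sphForm L p q p' q' x ∂haarU =
      if p = p' ∧ q = q' then ((L : ℂ) + 1) ^ 2 / (((p : ℂ) + 1) * ((q : ℂ) + 1)) else 0 := by
  have hi : ∀ s u, Integrable
      (fun x => sph L p q x s u * star (sph L p' q' x s u)) haarU := fun s u =>
    integrable_haarU (((continuous_sph L p q).matrix_elem _ _).mul
      ((continuous_sph L p' q').matrix_elem _ _).star)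
  simp_rw [sphForm_eq_sum]
  rw [integral_finsetSum _ fun X _ => integrable_finsetSum _ fun Y _ => hi X Y]
  simp_rw [integral_finsetSum _ fun Y _ => hi _ Y, integral_sph_mul_star]
  split_ifs with h
  · obtain ⟨rfl, rfl⟩ := h
    simp_rw [T₂_orthogonality]
    have hnorm : ∀ s, ∑ I, star (beta p q L I s) * beta p q L I s = 1 := by
      intro s
      have := congrFun (congrFun hβ.isometry s) s
      rw [Matrix.mul_apply, Matrix.one_apply_eq] at this
      simpa only [Matrix.conjTranspose_apply] using this
    have hin : ∀ s u, (∑ X : Idx p q × Idx p q,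
        ∑ Y : Idx p q × Idx p q,
        (star (beta p q L X.1 s) * beta p q L X.2 u) *
        star (star (beta p q L Y.1 s) * beta p q L Y.2 u) *
        if X = Y then (((p : ℂ) + 1) * ((q : ℂ) + 1))⁻¹ else 0) =
        (((p : ℂ) + 1) * ((q : ℂ) + 1))⁻¹ := by
      intro s u
      have : ∀ X : Idx p q × Idx p q,
          (∑ Y : Idx p q × Idx p q,
          (star (beta p q L X.1 s) * beta p q L X.2 u) *
          star (star (beta p q L Y.1 s) * beta p q L Y.2 u) *
          if X = Y then (((p : ℂ) + 1) * ((q : ℂ) + 1))⁻¹ else 0) =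
          ((star (beta p q L X.1 s) * beta p q L X.1 s) *
            (star (beta p q L X.2 u) * beta p q L X.2 u)) *
            (((p : ℂ) + 1) * ((q : ℂ) + 1))⁻¹ := by
        intro X
        rw [Finset.sum_eq_single X]
        · rw [if_pos rfl, star_mul', star_star]
          ring
        · intro Y _ hY
          rw [if_neg hY.symm, mul_zero]
        · simp
      simp_rw [this]
      rw [← Finset.sum_mul, Fintype.sum_prod_type]
      simp only
      rw [← Finset.sum_mul_sum, hnorm, hnorm]
      ring
    simp_rw [hin]
    simp only [Finset.sum_const, Finset.card_univ, Fintype.card_fin, nsmul_eq_mul]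
    push_cast
    ring
  · simp_rw [T₂_orthogonality_of_ne h]
    simp

/-! ### Descent from `U` to the torus -/

section Invariance

variable {L p q p' q' : ℕ} (hβ : IsIsometricIntertwiner p q L (beta p q L))
  (hβ' : IsIsometricIntertwiner p' q' L (beta p' q' L))

include hβ hβ'

theorem sphForm_mul_left (k : K) (x : U) :
    sphForm L p q p' q' ((k, k) * x) = sphForm L p q p' q' x := by
  rw [sphForm, sph_mul_left hβ, sph_mul_left hβ', Matrix.conjTranspose_mul, Matrix.mul_assoc,
    Matrix.trace_mul_comm]
  simp only [Matrix.mul_assoc]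
  rw [conjTranspose_T_mul, Matrix.mul_one]
  rfl

theorem sphForm_mul_right (k : K) (x : U) :
    sphForm L p q p' q' (x * (k, k)) = sphForm L p q p' q' x := by
  rw [sphForm, sph_mul_right hβ, sph_mul_right hβ', Matrix.conjTranspose_mul, Matrix.mul_assoc,
    ← Matrix.mul_assoc (T L k), T_mul_conjTranspose, Matrix.one_mul]
  rfl

theorem isClassFunction_sphForm : IsClassFunction fun k => sphForm L p q p' q' (k, 1) := by
  intro g k
  have : ((g * k * g⁻¹, 1) : U) = (g, g) * (k, 1) * (g⁻¹, g⁻¹) := by simp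
  simp only
  rw [this, sphForm_mul_right hβ hβ', sphForm_mul_left hβ hβ']

/-- Left `K_*`-invariance replaces `(k₁, k₂)` by `(k₂⁻¹ k₁, 1)`, so the inner integral does not
depend on `k₂`. -/
theorem integral_sphForm_haarK :
    ∫ k, sphForm L p q p' q' (k, 1) ∂haarK = ∫ x, sphForm L p q p' q' x ∂haarU := by
  rw [haarU, integral_prod_symm _ (integrable_haarU (continuous_sphForm L p q p' q'))]
  have : ∀ k₂ : K, ∫ k₁, sphForm L p q p' q' (k₁, k₂) ∂haarK =
      ∫ k, sphForm L p q p' q' (k, 1) ∂haarK := by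
    intro k₂
    refine Eq.trans ?_ (integral_mul_left_eq_self (fun k => sphForm L p q p' q' (k, 1)) k₂⁻¹)
    refine integral_congr_ae (Filter.Eventually.of_forall fun k₁ => ?_)
    have : ((k₁, k₂) : U) = (k₂, k₂) * (k₂⁻¹ * k₁, 1) := by simp
    simp only [this, sphForm_mul_left hβ hβ']
  simp_rw [this]
  simp

/-- Multiplication by `(m_t, m_t)` doubles the angle in the first factor; hence the argument `2 * t`
in `weyl_integration`. -/
theorem sphForm_a (t : ℝ) : sphForm L p q p' q' (a t).1 = sphForm L p q p' q' (m (2 * t), 1) := by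
  have : ((m t, m t) : U) * (m t, m (-t)) = (m (2 * t), 1) := by
    rw [Prod.mk_mul_mk, m_mul_m, m_mul_m, add_neg_cancel, m_zero, two_mul]
  rw [← this, sphForm_mul_left hβ hβ']
  rfl

/-- The integral over the torus of `tr (Φ Φ'*)` against the Weyl density. -/
theorem integral_sin_sq_mul_sphForm :
    ∫ t in (0 : ℝ)..4 * Real.pi, ((Real.sin t ^ 2 : ℝ) : ℂ) * sphForm L p q p' q' (a t).1 =
      2 * Real.pi * if p = p' ∧ q = q' then
        ((L : ℂ) + 1) ^ 2 / (((p : ℂ) + 1) * ((q : ℂ) + 1)) else 0 := by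
  rw [← integral_sphForm_haarU hβ, ← integral_sphForm_haarK hβ hβ']
  simp_rw [sphForm_a hβ hβ']
  refine weyl_integration (isClassFunction_sphForm hβ hβ')
    -- One exponential for each matrix entry and each pair of tensor weight vectors. At angle `2 *
    -- t` the half-integral weights give integral frequencies.
    (σ := (Fin (L + 1) × Fin (L + 1)) × Idx p q × Idx p' q')
    (fun x => (star (beta p q L x.2.1 x.1.1) * beta p q L x.2.1 x.1.2) *
      star (star (beta p' q' L x.2.2 x.1.1) * beta p' q' L x.2.2 x.1.2))
    (fun x => ((p : ℤ) - 2 * (x.2.1.1 : ℕ)) - ((p' : ℤ) - 2 * (x.2.2.1 : ℕ))) fun t => ?_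
  have hd : ∀ (p q : ℕ) (s u : Fin (L + 1)), sph L p q (m (2 * t), 1) s u =
      ∑ I : Idx p q, (star (beta p q L I s) * beta p q L I u) *
        Complex.exp ((((p : ℤ) - 2 * (I.1 : ℕ) : ℤ) : ℂ) * t * Complex.I) := by
    intro p q s u
    rw [sph_apply, Fintype.sum_prod_type (α₁ := Idx p q)]
    refine Finset.sum_congr rfl fun (I : Idx p q) _ => ?_
    rw [Finset.sum_eq_single I]
    · simp only [T₂, Matrix.kroneckerMap_apply, T_m', T_one, Matrix.diagonal_apply_eq,
        Matrix.one_apply_eq, mul_one]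
      congr 2
      push_cast
      ring
    · intro J _ hJ
      have : T₂ p q (m (2 * t), 1) I J = 0 := by
        simp only [T₂, Matrix.kroneckerMap_apply, T_m', T_one]
        by_cases h1 : I.1 = J.1
        · rw [Matrix.one_apply_ne (fun h2 => hJ (Prod.ext h1 h2).symm), mul_zero]
        · rw [Matrix.diagonal_apply_ne _ h1, zero_mul]
      rw [this, mul_zero]
    · simp
  rw [sphForm_eq_sum, Fintype.sum_prod_type (α₁ := Fin (L + 1) × Fin (L + 1)),
    Fintype.sum_prod_type (α₁ := Fin (L + 1))]
  refine Finset.sum_congr rfl fun s _ => ?_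
  refine Finset.sum_congr rfl fun u _ => ?_
  rw [hd, hd, star_sum, Finset.sum_mul_sum, Fintype.sum_prod_type (α₁ := Idx p q)]
  refine Finset.sum_congr rfl fun I _ => ?_
  refine Finset.sum_congr rfl fun J _ => ?_
  have hstar : ∀ n : ℤ, star (Complex.exp ((n : ℂ) * t * Complex.I)) =
      Complex.exp (-((n : ℂ) * t * Complex.I)) := by
    intro n
    rw [RCLike.star_def, ← Complex.exp_conj]
    congr 1
    simp
  have hexp : ∀ x y : ℤ, Complex.exp (((x - y : ℤ) : ℂ) * t * Complex.I) =
      Complex.exp ((x : ℂ) * t * Complex.I) * Complex.exp (-((y : ℂ) * t * Complex.I)) := by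
    intro x y
    rw [← Complex.exp_add]
    congr 1
    push_cast
    ring
  rw [star_mul' (star (beta p' q' L J s) * _), hstar, hexp ((p : ℤ) - 2 * (I.1 : ℕ)) ((p' : ℤ) - 2 * (J.1 : ℕ))]
  ring

end Invariance

/-- The point `a_t` commutes with `(m_s, m_s)`, so `Φ(a_t)` preserves the weight spaces of `H^ℓ`,
which are one-dimensional. -/
theorem sph_a_apply_ne {L p q : ℕ} (hβ : IsIsometricIntertwiner p q L (beta p q L)) (t : ℝ)
    {i j : Fin (L + 1)} (hij : i ≠ j) : sph L p q (a t).1 i j = 0 := by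
  by_contra hne
  have h := weight_eq_of_intertwines (B := sph L p q (a t).1)
    (x := fun i : Fin (L + 1) => (L : ℤ) - 2 * (i : ℕ))
    (y := fun i : Fin (L + 1) => (L : ℤ) - 2 * (i : ℕ)) (fun s => ?_) hne
  · exact hij (Fin.ext (by omega))
  · rw [← T_m', ← sph_mul_left hβ, ← sph_mul_right hβ]
    congr 1
    change (m s * m t, m s * m (-t)) = (m t * m s, m (-t) * m s)
    simp only [m_mul_m, add_comm]

theorem sphForm_a_eq_sum {L p q : ℕ} (hβ : IsIsometricIntertwiner p q L (beta p q L))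
    (p' q' : ℕ) (t : ℝ) : sphForm L p q p' q' (a t).1 =
      ∑ r, sph L p q (a t).1 r r * star (sph L p' q' (a t).1 r r) := by
  rw [sphForm_eq_sum]
  refine Finset.sum_congr rfl fun r _ => Finset.sum_eq_single r (fun u _ hu => ?_) (by simp)
  rw [sph_a_apply_ne hβ t hu.symm, zero_mul]

theorem integral_sin_sq_mul_Phi (L d d' : ℕ) (p q : Fin (L + 1)) :
    ∫ t in (0 : ℝ)..4 * Real.pi, ((Real.sin t ^ 2 : ℝ) : ℂ) *
        (Phi L d (a t) * (Phi L d' (a t))ᴴ) p q =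
      2 * Real.pi * if d = d' ∧ p = q then
        ((L : ℂ) + 1) ^ 2 / (((d : ℂ) + p + 1) * ((d : ℂ) + (L - p) + 1)) else 0 := by
  have hp : (p : ℕ) ≤ L := Nat.lt_succ_iff.mp p.2
  have hq : (q : ℕ) ≤ L := Nat.lt_succ_iff.mp q.2
  have hβ := beta_spec_add (d := d) hp
  have hβ' := beta_spec_add (d := d') hq
  have e : ∀ t, (Phi L d (a t) * (Phi L d' (a t))ᴴ) p q =
      sphForm L (d + p) (d + (L - p)) (d' + q) (d' + (L - q)) (a t).1 := by
    intro t
    rw [sphForm_a_eq_sum hβ, Matrix.mul_apply]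
    rfl
  simp_rw [e]
  rw [integral_sin_sq_mul_sphForm hβ hβ']
  congr 1
  -- Injectivity of `ζ`: the sum of the doubled labels gives `d`, and then the first label gives
  -- `p`.
  have hiff : (d + (p : ℕ) = d' + q ∧ d + (L - (p : ℕ)) = d' + (L - q)) ↔ (d = d' ∧ p = q) := by
    rw [Fin.ext_iff]
    omega
  simp only [hiff]
  push_cast [hp]
  rfl

/-! ### Invertibility of `Φ₀` -/

theorem T₂_m (p q : ℕ) (s t : ℝ) : T₂ p q (m s, m t) = Matrix.diagonal fun I : Idx p q =>
    Complex.exp (((p : ℂ) - 2 * (I.1 : ℕ)) * (s / 2) * Complex.I) *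
      Complex.exp (((q : ℂ) - 2 * (I.2 : ℕ)) * (t / 2) * Complex.I) := by
  rw [T₂, T_m, T_m, Matrix.diagonal_kronecker_diagonal]

/-! ### The Cartan embedding and the generating function of `Φ_0` -/

/-- The matrix of the embedding `H^ℓ → H^{ℓ₁} ⊗ H^{ℓ₂}` for `ℓ = ℓ₁ + ℓ₂`. -/
def cartan (p q L : ℕ) : Matrix (Idx p q) (Fin (L + 1)) ℂ :=
  Matrix.of fun I s => if (I.1 : ℕ) + (I.2 : ℕ) = s then
    ((Real.sqrt (p.choose I.1) : ℝ) : ℂ) * ((Real.sqrt (q.choose I.2) : ℝ) : ℂ) /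
      ((Real.sqrt (L.choose s) : ℝ) : ℂ) else 0

theorem cartan_mul_sqrt_choose (p q L : ℕ) (I : Idx p q) (s : Fin (L + 1)) :
    cartan p q L I s * ((Real.sqrt (L.choose s) : ℝ) : ℂ) * cartan p q L I s =
      ((Real.sqrt (p.choose I.1) : ℝ) : ℂ) * ((Real.sqrt (q.choose I.2) : ℝ) : ℂ) *
        cartan p q L I s := by
  rw [cartan, Matrix.of_apply]
  split_ifs
  · rw [div_mul_cancel₀ _ (sqrt_choose_ne_zero s)]
  · simp

theorem star_cartan (p q L : ℕ) (I : Idx p q) (s : Fin (L + 1)) :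
    star (cartan p q L I s) = cartan p q L I s := by
  rw [cartan, Matrix.of_apply]
  split_ifs
  · simp
  · simp

theorem ev_exp (n : ℕ) (j : Fin (n + 1)) (t : ℝ) :
    ((Real.sqrt (n.choose j) : ℝ) : ℂ) *
      Complex.exp (((n : ℂ) - 2 * (j : ℕ)) * (t / 2) * Complex.I) =
      ev n j ![Complex.exp (Complex.I * t / 2), Complex.exp (-(Complex.I * t / 2))] := by
  have hj : (j : ℕ) ≤ n := Nat.lt_succ_iff.mp j.2
  simp only [ev, Matrix.cons_val_zero, Matrix.cons_val_one]
  rw [← Complex.exp_nat_mul, ← Complex.exp_nat_mul, ← Complex.exp_add]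
  congr 2
  push_cast [hj]
  ring

section

variable {p q L : ℕ} (hpq : p + q = L)

include hpq

/-- The transpose of `cartan` is the multiplication map `ψ_i ⊗ ψ_j ↦ ψ_i ψ_j`, which commutes with
substitutions; this is the source of the intertwining property. -/
theorem sum_ev_mul_cartan (I : Idx p q) (v : Fin 2 → ℂ) :
    ∑ s, ev L s v * cartan p q L I s = ev p I.1 v * ev q I.2 v := by
  have h1 := I.1.2
  have h2 := I.2.2
  have hs : (I.1 : ℕ) + (I.2 : ℕ) < L + 1 := by omega
  rw [Finset.sum_eq_single (⟨(I.1 : ℕ) + (I.2 : ℕ), hs⟩ : Fin (L + 1))]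
  · have h0 := sqrt_choose_ne_zero (⟨(I.1 : ℕ) + (I.2 : ℕ), hs⟩ : Fin (L + 1))
    have e : L - ((I.1 : ℕ) + (I.2 : ℕ)) = (p - (I.1 : ℕ)) + (q - (I.2 : ℕ)) := by omega
    simp only [ev, cartan, Matrix.of_apply, if_true, e] at h0 ⊢
    rw [pow_add, pow_add]
    field_simp
  · intro b _ hb
    rw [cartan, Matrix.of_apply, if_neg (fun h => hb (Fin.ext h.symm)), mul_zero]
  · simp

theorem Tm_mul_cartan_transpose (g : Matrix (Fin 2) (Fin 2) ℂ) :
    Tm L g * (cartan p q L)ᵀ = (cartan p q L)ᵀ * (Tm p g ⊗ₖ Tm q g) := by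
  ext s I
  refine congrFun (ev_ext (c := fun s => (Tm L g * (cartan p q L)ᵀ) s I)
    (d := fun s => ((cartan p q L)ᵀ * (Tm p g ⊗ₖ Tm q g)) s I) fun v => ?_) s
  have e1 : ∑ s, ev L s v * (Tm L g * (cartan p q L)ᵀ) s I =
      ∑ r, (∑ s, ev L s v * Tm L g s r) * cartan p q L I r := by
    simp_rw [Matrix.mul_apply, Finset.mul_sum, Finset.sum_mul, Matrix.transpose_apply, mul_assoc]
    exact Finset.sum_comm
  have e2 : ∑ s, ev L s v * ((cartan p q L)ᵀ * (Tm p g ⊗ₖ Tm q g)) s I =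
      ∑ J : Idx p q, (∑ s, ev L s v * cartan p q L J s) * (Tm p g J.1 I.1 * Tm q g J.2 I.2) := by
    simp_rw [Matrix.mul_apply, Finset.mul_sum, Finset.sum_mul, Matrix.transpose_apply, mul_assoc]
    exact Finset.sum_comm
  rw [e1, e2]
  simp_rw [sum_ev_mul_Tm, sum_ev_mul_cartan hpq]
  rw [← sum_ev_mul_Tm, ← sum_ev_mul_Tm, Finset.sum_mul_sum, Fintype.sum_prod_type]
  exact Finset.sum_congr rfl fun _ _ => Finset.sum_congr rfl fun _ _ => by ring

theorem cartan_intertwines (k : K) : T₂ p q (k, k) * cartan p q L = cartan p q L * T L k := by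
  have h := congrArg Matrix.transpose
    (Tm_mul_cartan_transpose hpq (k : Matrix (Fin 2) (Fin 2) ℂ)ᵀ)
  rw [Matrix.transpose_mul, Matrix.transpose_mul, Matrix.transpose_transpose, Tm_transpose,
    Tm_transpose, Tm_transpose, Matrix.transpose_transpose] at h
  exact h.symm

/-- Schur's lemma reduces this to the norm of column `0`, whose only nonzero entry is a 1 at `(0,
0)`. -/
theorem cartan_isometry : (cartan p q L)ᴴ * cartan p q L = 1 := by
  rw [conjTranspose_mul_self_eq_smul (cartan_intertwines hpq), Finset.sum_eq_single (0, 0)]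
  · simp [cartan]
  · intro I _ hI
    have : ¬ ((I.1 : ℕ) + (I.2 : ℕ) = 0) := fun h =>
      hI (Prod.ext (Fin.ext (show (I.1 : ℕ) = 0 by omega)) (Fin.ext (show (I.2 : ℕ) = 0 by omega)))
    simp only [cartan, Matrix.of_apply, Fin.val_zero, this, if_false]
    simp
  · simp

/-- For `ℓ = ℓ₁ + ℓ₂` the isometric intertwiner is unique up to a scalar of modulus one. -/
theorem eq_smul_cartan {β : Matrix (Idx p q) (Fin (L + 1)) ℂ}
    (hβ : IsIsometricIntertwiner p q L β) : ∃ c : ℂ, star c * c = 1 ∧ β = c • cartan p q L := by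
  have hw : ∀ I : Idx p q, I ≠ (0, 0) → β I 0 = 0 := by
    intro I hI
    by_contra hne
    have h := weight_eq_of_intertwines (B := β)
      (x := fun I : Idx p q => ((p : ℤ) - 2 * (I.1 : ℕ)) + ((q : ℤ) - 2 * (I.2 : ℕ)))
      (y := fun i : Fin (L + 1) => (L : ℤ) - 2 * (i : ℕ)) (fun s => ?_) hne
    · simp only [Fin.val_zero] at h
      exact hI (Prod.ext (Fin.ext (show (I.1 : ℕ) = 0 by omega)) (Fin.ext (show (I.2 : ℕ) = 0 by omega)))
    · rw [← T_m', ← hβ.intertwines, T₂_m]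
      congr 2
      ext I
      rw [← Complex.exp_add]
      congr 1
      push_cast
      ring
  have h00 : cartan p q L (0, 0) 0 = 1 := by simp [cartan]
  -- The highest weight of the tensor product is simple, so this difference has zero column `0`;
  -- being an intertwiner, it vanishes.
  have hint : ∀ k : K, T₂ p q (k, k) * (β - β (0, 0) 0 • cartan p q L) =
      (β - β (0, 0) 0 • cartan p q L) * T L k := by
    intro k
    rw [Matrix.mul_sub, Matrix.sub_mul, Matrix.mul_smul, Matrix.smul_mul, hβ.intertwines,
      cartan_intertwines hpq]
  have h0 := conjTranspose_mul_self_eq_smul hint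
  rw [Finset.sum_eq_zero, Complex.ofReal_zero, zero_smul] at h0
  · have hβ' : β = β (0, 0) 0 • cartan p q L := by
      open ComplexOrder in
      exact sub_eq_zero.mp (Matrix.conjTranspose_mul_self_eq_zero.mp h0)
    refine ⟨β (0, 0) 0, ?_, hβ'⟩
    have h1 := hβ.isometry
    rw [hβ', Matrix.conjTranspose_smul, Matrix.smul_mul, Matrix.mul_smul, cartan_isometry hpq,
      smul_smul] at h1
    have := congrFun (congrFun h1 0) 0
    simpa [h00] using this
  · intro I _
    by_cases hI : I = (0, 0)
    · subst hI
      simp [h00]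
    · have : cartan p q L I 0 = 0 := by
        have : ¬ ((I.1 : ℕ) + (I.2 : ℕ) = 0) := fun h =>
          hI (Prod.ext (Fin.ext (show (I.1 : ℕ) = 0 by omega)) (Fin.ext (show (I.2 : ℕ) = 0 by omega)))
        simp only [cartan, Matrix.of_apply, Fin.val_zero, this, if_false]
      simp [hw I hI, this]

theorem sph_a_apply_self (hβ : IsIsometricIntertwiner p q L (beta p q L)) (t : ℝ)
    (s : Fin (L + 1)) : sph L p q (a t).1 s s = ∑ I : Idx p q,
      cartan p q L I s * cartan p q L I s *
        (Complex.exp (((p : ℂ) - 2 * (I.1 : ℕ)) * (t / 2) * Complex.I) *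
          Complex.exp (((q : ℂ) - 2 * (I.2 : ℕ)) * (((-t : ℝ) : ℂ) / 2) * Complex.I)) := by
  obtain ⟨c, hc, hβc⟩ := eq_smul_cartan hpq hβ
  have hs : sph L p q (a t).1 = (cartan p q L)ᴴ * T₂ p q (m t, m (-t)) * cartan p q L := by
    rw [sph, hβc, Matrix.conjTranspose_smul, Matrix.mul_smul, Matrix.smul_mul, Matrix.smul_mul,
      smul_smul, mul_comm c, hc, one_smul]
    rfl
  rw [hs, T₂_m, Matrix.mul_apply]
  refine Finset.sum_congr rfl fun I _ => ?_
  rw [Matrix.mul_diagonal, Matrix.conjTranspose_apply, star_cartan]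
  ring

/-- Multiplication of polynomials turns the double sum into a product of two kernels from
`sum_ev_mul_ev`, one for each tensor factor. -/
theorem sum_ev_mul_sph (hβ : IsIsometricIntertwiner p q L (beta p q L)) (t : ℝ)
    (v : Fin 2 → ℂ) :
    ∑ s, ev L s v * (((Real.sqrt (L.choose s) : ℝ) : ℂ) * sph L p q (a t).1 s s) =
      (v 0 * Complex.exp (Complex.I * t / 2) + v 1 * Complex.exp (-(Complex.I * t / 2))) ^ p *
      (v 0 * Complex.exp (-(Complex.I * t / 2)) + v 1 * Complex.exp (Complex.I * t / 2)) ^ q := by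
  have e : ∑ s, ev L s v * (((Real.sqrt (L.choose s) : ℝ) : ℂ) * sph L p q (a t).1 s s) =
      ∑ I : Idx p q, (∑ s, ev L s v * cartan p q L I s) *
        ((((Real.sqrt (p.choose I.1) : ℝ) : ℂ) *
          Complex.exp (((p : ℂ) - 2 * (I.1 : ℕ)) * (t / 2) * Complex.I)) *
        (((Real.sqrt (q.choose I.2) : ℝ) : ℂ) *
          Complex.exp (((q : ℂ) - 2 * (I.2 : ℕ)) * (((-t : ℝ) : ℂ) / 2) * Complex.I))) := by
    simp_rw [sph_a_apply_self hpq hβ, Finset.mul_sum, Finset.sum_mul]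
    rw [Finset.sum_comm]
    refine Finset.sum_congr rfl fun I _ => ?_
    refine Finset.sum_congr rfl fun s _ => ?_
    linear_combination (ev L s v *
      (Complex.exp (((p : ℂ) - 2 * (I.1 : ℕ)) * (t / 2) * Complex.I) *
          Complex.exp (((q : ℂ) - 2 * (I.2 : ℕ)) * (((-t : ℝ) : ℂ) / 2) * Complex.I))) *
      cartan_mul_sqrt_choose p q L I s
  rw [e]
  simp_rw [sum_ev_mul_cartan hpq, ev_exp]
  rw [Fintype.sum_prod_type]
  have h1 := sum_ev_mul_ev p v ![Complex.exp (Complex.I * t / 2), Complex.exp (-(Complex.I * t / 2))]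
  have h2 := sum_ev_mul_ev q v ![Complex.exp (Complex.I * ((-t : ℝ) : ℂ) / 2),
    Complex.exp (-(Complex.I * ((-t : ℝ) : ℂ) / 2))]
  have e1 : Complex.I * ((-t : ℝ) : ℂ) / 2 = -(Complex.I * t / 2) := by push_cast; ring
  rw [e1, neg_neg] at h2 ⊢
  simp only [Matrix.cons_val_zero, Matrix.cons_val_one] at h1 h2
  rw [← h1, ← h2, Finset.sum_mul_sum]
  exact Finset.sum_congr rfl fun _ _ => Finset.sum_congr rfl fun _ _ => by ring

end

/-- `Φ₀(a_t)` is a rescaled transpose of the matrix of an action on binary forms. -/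
theorem sqrt_choose_mul_Phi_zero (L : ℕ) (t : ℝ) (r s : Fin (L + 1)) :
    ((Real.sqrt (L.choose r) : ℝ) : ℂ) * Phi L 0 (a t) r s * ((Real.sqrt (L.choose s) : ℝ) : ℂ) =
      Tm L !![Complex.exp (-(Complex.I * t / 2)), Complex.exp (Complex.I * t / 2);
        Complex.exp (Complex.I * t / 2), Complex.exp (-(Complex.I * t / 2))] s r := by
  have hr : (r : ℕ) ≤ L := Nat.lt_succ_iff.mp r.2
  have hβ := beta_spec_add (d := 0) hr
  refine congrFun (ev_ext
    (c := fun s => ((Real.sqrt (L.choose r) : ℝ) : ℂ) * Phi L 0 (a t) r s *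
      ((Real.sqrt (L.choose s) : ℝ) : ℂ)) (d := fun s => Tm L _ s r) fun v => ?_) s
  rw [sum_ev_mul_Tm]
  have h := sum_ev_mul_sph (by omega) hβ t v
  have e : ∑ s, ev L s v * (((Real.sqrt (L.choose r) : ℝ) : ℂ) * Phi L 0 (a t) r s *
      ((Real.sqrt (L.choose s) : ℝ) : ℂ)) = ((Real.sqrt (L.choose r) : ℝ) : ℂ) *
      ∑ s, ev L s v * (((Real.sqrt (L.choose s) : ℝ) : ℂ) *
        sph L (0 + (r : ℕ)) (0 + (L - (r : ℕ))) (a t).1 s s) := by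
    rw [Finset.mul_sum]
    refine Finset.sum_congr rfl fun s _ => ?_
    simp only [Phi, Matrix.of_apply]
    ring
  rw [e, h]
  simp [ev, Matrix.mulVec, dotProduct, Fin.sum_univ_two]
  left
  ring

/-- Since `Tm` is multiplicative, `Tm L g` is invertible once `g` is, and `det g = e^{-it} - e^{it}
= -2i sin t`. A singular `Φ_0(a_t)` would make `Tm L g` singular. -/
theorem isUnit_Phi_zero (L : ℕ) {t : ℝ} (ht : Real.sin t ≠ 0) : IsUnit (Phi L 0 (a t)) := by
  set g : Matrix (Fin 2) (Fin 2) ℂ :=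
    !![Complex.exp (-(Complex.I * t / 2)), Complex.exp (Complex.I * t / 2);
        Complex.exp (Complex.I * t / 2), Complex.exp (-(Complex.I * t / 2))] with hg
  have hdet : g.det ≠ 0 := by
    have : g.det = -(2 * Complex.I * (Real.sin t : ℝ)) := by
      rw [hg, Matrix.det_fin_two_of, ← Complex.exp_add, ← Complex.exp_add, Complex.ofReal_sin,
        Complex.sin]
      rw [show -(Complex.I * t / 2) + -(Complex.I * t / 2) = -t * Complex.I by ring,
        show Complex.I * t / 2 + Complex.I * t / 2 = t * Complex.I by ring]
      linear_combination (Complex.exp (-t * Complex.I) - Complex.exp (t * Complex.I)) *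
        Complex.I_mul_I
    rw [this, neg_ne_zero]
    exact mul_ne_zero (mul_ne_zero two_ne_zero Complex.I_ne_zero) (Complex.ofReal_ne_zero.mpr ht)
  have hT : (Tm L g).det ≠ 0 := by
    have h : (Tm L g * Tm L g⁻¹).det = 1 := by
      rw [← Tm_mul, Matrix.mul_nonsing_inv _ (isUnit_iff_ne_zero.mpr hdet), Tm_one,
        Matrix.det_one]
    rw [Matrix.det_mul] at h
    exact left_ne_zero_of_mul_eq_one h
  rw [Matrix.isUnit_iff_isUnit_det, isUnit_iff_ne_zero]
  intro h0
  apply hT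
  have : (Tm L g)ᵀ = Matrix.diagonal (fun r : Fin (L + 1) => ((Real.sqrt (L.choose r) : ℝ) : ℂ)) *
      Phi L 0 (a t) * Matrix.diagonal fun s : Fin (L + 1) =>
        ((Real.sqrt (L.choose s) : ℝ) : ℂ) := by
    ext r s
    rw [Matrix.mul_diagonal, Matrix.diagonal_mul, sqrt_choose_mul_Phi_zero, Matrix.transpose_apply]
  rw [← Matrix.det_transpose, this, Matrix.det_mul, Matrix.det_mul, h0, mul_zero, zero_mul]

/-! ### The measure on `A_*` -/

theorem continuous_m : Continuous m := by
  refine Continuous.subtype_mk (continuous_matrix fun i j => ?_) _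
  fin_cases i <;> fin_cases j <;> simp <;> fun_prop

theorem continuous_a : Continuous a :=
  Continuous.subtype_mk (continuous_m.prodMk (continuous_m.comp continuous_neg)) _

theorem exists_eq_a (x : A) : ∃ t ∈ Set.Ico (0 : ℝ) (4 * Real.pi), x = a t := by
  obtain ⟨t, ht, h⟩ := x.2
  exact ⟨t, ht, Subtype.ext h⟩

instance : CompactSpace A := by
  constructor
  have : (Set.univ : Set A) = a '' Set.Icc 0 (4 * Real.pi) := by
    refine (Set.eq_univ_of_forall fun x => ?_).symm
    obtain ⟨t, ht, rfl⟩ := exists_eq_a x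
    exact ⟨t, Set.Ico_subset_Icc_self ht, rfl⟩
  rw [this]
  exact isCompact_Icc.image continuous_a

instance : IsFiniteMeasure da := by
  unfold da
  have : IsFiniteMeasure
      (ENNReal.ofReal (1 / 4) • volume.restrict (Set.Ico (0 : ℝ) (4 * Real.pi))) :=
    Measure.smul_finite _ ENNReal.ofReal_ne_top
  infer_instance

instance : da.IsOpenPosMeasure := by
  constructor
  rintro O hO ⟨x, hx⟩
  obtain ⟨t, ht, rfl⟩ := exists_eq_a x
  have hp : (0 : ℝ) < 4 * Real.pi := by positivity
  rw [da, Measure.map_apply continuous_a.measurable hO.measurableSet, Measure.smul_apply,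
    Measure.restrict_apply (continuous_a.measurable hO.measurableSet), smul_eq_mul]
  refine mul_ne_zero (by simp) ?_
  have hO' : IsOpen (a ⁻¹' O) := hO.preimage continuous_a
  -- The parameter `t` may be the endpoint `0`, so an interior point is obtained by density.
  have hne : (a ⁻¹' O ∩ Set.Ioo 0 (4 * Real.pi)).Nonempty := by
    have hcl : t ∈ closure (Set.Ioo 0 (4 * Real.pi)) := by
      rw [closure_Ioo hp.ne]
      exact Set.Ico_subset_Icc_self ht
    exact mem_closure_iff.mp hcl _ hO' hx
  refine ne_of_gt (lt_of_lt_of_le ((hO'.inter isOpen_Ioo).measure_pos volume hne)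
    (measure_mono (Set.inter_subset_inter_right _ Set.Ioo_subset_Ico_self)))

theorem continuous_D : Continuous D := by
  have h : Continuous fun x : A => (x.1.1 : Matrix (Fin 2) (Fin 2) ℂ) 0 0 :=
    ((continuous_subtype_val.comp continuous_fst).matrix_elem 0 0).comp continuous_subtype_val
  exact (Complex.continuous_im.comp (h.pow 2)).pow 2

theorem integral_da {f : A → ℂ} (hf : Continuous f) :
    ∫ x, f x ∂da = 1 / 4 * ∫ t in (0 : ℝ)..4 * Real.pi, f (a t) := by
  have hp : (0 : ℝ) ≤ 4 * Real.pi := by positivity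
  rw [da, integral_map continuous_a.measurable.aemeasurable hf.aestronglyMeasurable,
    integral_smul_measure, intervalIntegral.integral_of_le hp, integral_Ico_eq_integral_Ioc,
    ENNReal.toReal_ofReal (by norm_num), Complex.real_smul]
  push_cast
  rfl

theorem integrable_da {f : A → ℂ} (hf : Continuous f) : Integrable f da :=
  hf.integrable_of_hasCompactSupport (HasCompactSupport.of_compactSpace f)

theorem ae_D_ne_zero : ∀ᵐ x ∂da, D x ≠ 0 := by
  rw [da, ae_map_iff continuous_a.measurable.aemeasurable
    (isOpen_ne_fun continuous_D continuous_const).measurableSet]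
  refine Measure.ae_smul_measure (ae_restrict_of_ae ?_) _
  have hc : (Set.range fun n : ℤ => (n : ℝ) * Real.pi).Countable := Set.countable_range _
  filter_upwards [hc.ae_notMem volume] with t ht h
  rw [D_a] at h
  exact ht (Real.sin_eq_zero_iff.mp (pow_eq_zero_iff two_ne_zero |>.mp h))

theorem continuous_Phi (L d : ℕ) : Continuous (Phi L d) := by
  refine continuous_matrix fun p q => ?_
  exact ((continuous_sph _ _ _).matrix_elem q q).comp continuous_subtype_val

theorem isUnit_Phi_zero_of_D_ne_zero (L : ℕ) {x : A} (hx : D x ≠ 0) : IsUnit (Phi L 0 x) := by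
  obtain ⟨t, -, rfl⟩ := exists_eq_a x
  rw [D_a] at hx
  exact isUnit_Phi_zero L (pow_ne_zero_iff two_ne_zero |>.mp hx)

/-! ### Square integrable functions -/

section Weight

variable {L : ℕ} {G : Fn L}

/-- The matrix weight `G G* |D_*|`. -/
def weight (G : Fn L) : Fn L := fun x => ((|D x| : ℝ) : ℂ) • (G x * (G x)ᴴ)

/-- The function `|D_*|^{1/2} P G`. -/
def twist (G P : Fn L) : Fn L := fun x => ((Real.sqrt |D x| : ℝ) : ℂ) • (P x * G x)

/-- Factoring the weight turns the matrix pairing into sums of scalar `L²` products of the entries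
of `twist G P` and `twist G R`. -/
theorem mul_weight_mul (G P R : Fn L) (x : A) :
    P x * weight G x * (R x)ᴴ = twist G P x * (twist G R x)ᴴ := by
  have h : ((Real.sqrt |D x| : ℝ) : ℂ) * ((Real.sqrt |D x| : ℝ) : ℂ) = ((|D x| : ℝ) : ℂ) := by
    rw [← Complex.ofReal_mul, Real.mul_self_sqrt (abs_nonneg _)]
  simp only [weight, twist, Matrix.conjTranspose_smul, Matrix.conjTranspose_mul, Matrix.mul_smul,
    Matrix.smul_mul, smul_smul, RCLike.star_def, Complex.conj_ofReal, h, Matrix.mul_assoc]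

theorem twist_add (G P R : Fn L) : twist G (P + R) = twist G P + twist G R := by
  ext x : 1
  simp [twist, Matrix.add_mul]

theorem twist_mul_left (G P : Fn L) (M : Matrix (Fin (L + 1)) (Fin (L + 1)) ℂ) :
    twist G (fun x => M * P x) = fun x => M * twist G P x := by
  ext x : 1
  simp [twist, Matrix.mul_assoc]

theorem continuous_twist (hG : Continuous G) {P : Fn L} (hP : Continuous P) :
    Continuous (twist G P) :=
  Continuous.smul (Complex.continuous_ofReal.comp
    (Real.continuous_sqrt.comp (continuous_abs.comp continuous_D))) (hP.matrix_mul hG)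

theorem aestronglyMeasurable_twist (hG : Continuous G) {P : Fn L}
    (hP : ∀ i j, AEStronglyMeasurable (fun x => P x i j) da) (i j : Fin (L + 1)) :
    AEStronglyMeasurable (fun x => twist G P x i j) da := by
  have hs : Continuous fun x => ((Real.sqrt |D x| : ℝ) : ℂ) := Complex.continuous_ofReal.comp
    (Real.continuous_sqrt.comp (continuous_abs.comp continuous_D))
  simp only [twist, Matrix.smul_apply, Matrix.mul_apply, smul_eq_mul]
  refine hs.aestronglyMeasurable.mul ?_
  refine Finset.aestronglyMeasurable_fun_sum _ fun l _ => ?_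
  exact (hP i l).mul (hG.matrix_elem l j).aestronglyMeasurable

theorem mul_conjTranspose_self_apply {ι κ : Type*} [Fintype κ] (B : Matrix ι κ ℂ) (i : ι) :
    (B * Bᴴ) i i = ((∑ j, ‖B i j‖ ^ 2 : ℝ) : ℂ) := by
  rw [Matrix.mul_apply]
  push_cast
  refine Finset.sum_congr rfl fun j _ => ?_
  rw [Matrix.conjTranspose_apply, RCLike.star_def, RCLike.mul_conj]
  rfl

/-- Each diagonal entry of `P W P*` is the sum of the squared moduli of a row of `twist G P`, hence
dominates every one of them. -/
theorem mem_L2_weight_iff (hG : Continuous G) {P : Fn L} :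
    P ∈ L2 (weight G) ↔ (∀ i j, AEStronglyMeasurable (fun x => P x i j) da) ∧
      ∀ i j, MemLp (fun x => twist G P x i j) 2 da := by
  refine and_congr_right fun hP => ?_
  have hm := aestronglyMeasurable_twist hG hP
  simp only [mul_weight_mul, mul_conjTranspose_self_apply]
  constructor
  · intro h i j
    rw [memLp_two_iff_integrable_sq_norm (hm i j)]
    have hi : Integrable (fun x => ∑ l, ‖twist G P x i l‖ ^ 2) da := by
      simpa only [RCLike.re_to_complex, Complex.ofReal_re] using (h i).re
    refine hi.mono' ((hm i j).norm.pow 2) (Filter.Eventually.of_forall fun x => ?_)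
    rw [Real.norm_of_nonneg (by positivity)]
    exact Finset.single_le_sum (f := fun l => ‖twist G P x i l‖ ^ 2)
      (fun l _ => by positivity) (Finset.mem_univ j)
  · intro h i
    have hi : Integrable (fun x => ∑ l, ‖twist G P x i l‖ ^ 2) da :=
      integrable_finsetSum _ fun l _ => (memLp_two_iff_integrable_sq_norm (hm i l)).mp (h i l)
    exact hi.ofReal

theorem integrable_mul_weight_mul (hG : Continuous G) {P R : Fn L} (hP : P ∈ L2 (weight G))
    (hR : R ∈ L2 (weight G)) (i j : Fin (L + 1)) :
    Integrable (fun x => (P x * weight G x * (R x)ᴴ) i j) da := by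
  have e : ∀ x, (P x * weight G x * (R x)ᴴ) i j =
      ∑ l, twist G P x i l * star (twist G R x j l) := by
    intro x
    rw [mul_weight_mul, Matrix.mul_apply]
    rfl
  simp only [e]
  refine integrable_finsetSum _ fun l _ => ?_
  exact (((mem_L2_weight_iff hG).mp hP).2 i l).integrable_mul
    (((mem_L2_weight_iff hG).mp hR).2 j l).star

theorem continuous_mem_L2_weight (hG : Continuous G) {P : Fn L} (hP : Continuous P) :
    P ∈ L2 (weight G) :=
  (mem_L2_weight_iff hG).mpr ⟨fun i j => (hP.matrix_elem i j).aestronglyMeasurable, fun i j =>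
    ((continuous_twist hG hP).matrix_elem i j).memLp_of_hasCompactSupport
      (HasCompactSupport.of_compactSpace _)⟩

variable {c : ℝ} {B : Fn L → Fn L → Matrix (Fin (L + 1)) (Fin (L + 1)) ℂ}

/-- The pairing attached to an invertible matrix weight is a matrix valued inner product. -/
theorem isMatrixInnerProduct_weight (hG : Continuous G) (hGu : ∀ x, D x ≠ 0 → IsUnit (G x))
    (hc : 0 < c)
    (hB : ∀ P R, B P R = (c : ℂ) • matInt fun x => P x * weight G x * (R x)ᴴ) :
    IsMatrixInnerProduct (L2 (weight G)) B := by
  have hmem := fun P => mem_L2_weight_iff (P := P) hG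
  have hmul : ∀ (M : Matrix (Fin (L + 1)) (Fin (L + 1)) ℂ), ∀ P ∈ L2 (weight G),
      (fun x => M * P x) ∈ L2 (weight G) := by
    intro M P hP
    refine (hmem _).mpr ⟨fun i j => ?_, fun i j => ?_⟩
    · simp only [Matrix.mul_apply]
      exact Finset.aestronglyMeasurable_fun_sum _ fun l _ =>
        (((hmem P).mp hP).1 l j).const_mul _
    · rw [twist_mul_left]
      simp only [Matrix.mul_apply]
      exact memLp_finsetSum _ fun l _ => (((hmem P).mp hP).2 l j).const_mul _
  have hleft : ∀ (M : Matrix (Fin (L + 1)) (Fin (L + 1)) ℂ), ∀ P ∈ L2 (weight G),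
      ∀ R ∈ L2 (weight G), B (fun x => M * P x) R = M * B P R := by
    intro M P hP R hR
    rw [hB, hB, Matrix.mul_smul]
    congr 1
    ext i j
    simp only [matInt, Matrix.of_apply, Matrix.mul_assoc M]
    rw [Matrix.mul_apply]
    simp only [Matrix.mul_apply (M := M), Matrix.of_apply]
    rw [integral_finsetSum _ fun l _ =>
      (integrable_mul_weight_mul hG hP hR l j).const_mul _]
    exact Finset.sum_congr rfl fun l _ => integral_const_mul _ _
  have hherm : ∀ P ∈ L2 (weight G), ∀ R ∈ L2 (weight G), (B P R)ᴴ = B R P := by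
    intro P _ R _
    rw [hB, hB, Matrix.conjTranspose_smul, RCLike.star_def, Complex.conj_ofReal]
    congr 1
    ext i j
    simp only [matInt, Matrix.of_apply, Matrix.conjTranspose_apply, mul_weight_mul]
    rw [RCLike.star_def, ← integral_conj]
    congr 1
    ext x
    rw [← RCLike.star_def, ← Matrix.conjTranspose_apply, Matrix.conjTranspose_mul,
      Matrix.conjTranspose_conjTranspose]
  have hdiag : ∀ P i, B P P i i = ((c * ∫ x, ∑ j, ‖twist G P x i j‖ ^ 2 ∂da : ℝ) : ℂ) := by
    intro P i
    rw [hB, Matrix.smul_apply, matInt, Matrix.of_apply]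
    simp only [mul_weight_mul, mul_conjTranspose_self_apply]
    rw [smul_eq_mul, Complex.ofReal_mul]
    congr 1
    exact integral_ofReal
  refine ⟨?_, ?_, hmul, ?_, hleft, hherm, ?_, ?_⟩
  · exact continuous_mem_L2_weight hG continuous_zero
  · intro P hP R hR
    refine (hmem _).mpr ⟨fun i j => ?_, fun i j => ?_⟩
    · exact (((hmem P).mp hP).1 i j).add (((hmem R).mp hR).1 i j)
    · rw [twist_add]
      exact (((hmem P).mp hP).2 i j).add (((hmem R).mp hR).2 i j)
  · intro c₁ c₂ P₁ h₁ P₂ h₂ R hR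
    rw [hB, hB, hB, smul_comm c₁, smul_comm c₂, ← smul_add]
    congr 1
    ext i j
    simp only [matInt, Matrix.of_apply, Matrix.add_apply, Matrix.smul_apply, Pi.add_apply,
      Pi.smul_apply, Matrix.add_mul, Matrix.smul_mul, smul_eq_mul]
    rw [integral_add ((integrable_mul_weight_mul hG h₁ hR i j).const_mul _)
      ((integrable_mul_weight_mul hG h₂ hR i j).const_mul _), integral_const_mul,
      integral_const_mul]
  · intro P hP
    open ComplexOrder in
    refine Matrix.PosSemidef.of_dotProduct_mulVec_nonneg (hherm P hP P hP) fun x => ?_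
    -- All rows of `M` are `x*`, so `x* B(P,P) x` is the `(0,0)` entry of `M B(P,P) M* = B(MP, MP)`,
    -- an integral of squares by `hdiag`.
    set M : Matrix (Fin (L + 1)) (Fin (L + 1)) ℂ := Matrix.of fun _ j => star (x j) with hM
    have h := hdiag (fun y => M * P y) 0
    rw [hleft M P hP _ (hmul M P hP), ← hherm _ (hmul M P hP) P hP, hleft M P hP P hP,
      Matrix.conjTranspose_mul, hherm P hP P hP, ← Matrix.mul_assoc, Matrix.mul_assoc] at h
    have e : (M * (B P P * Mᴴ)) 0 0 = star x ⬝ᵥ (B P P *ᵥ x) := by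
      simp [Matrix.mul_apply, hM, dotProduct, Matrix.mulVec]
    rw [← e, h]
    open ComplexOrder in
    rw [Complex.zero_le_real]
    exact mul_nonneg hc.le (integral_nonneg fun _ => Finset.sum_nonneg fun _ _ => by positivity)
  · intro P hP h0
    have hz : ∀ i, ∀ᵐ x ∂da, ∀ j, twist G P x i j = 0 := by
      intro i
      have h1 := hdiag P i
      rw [h0, Matrix.zero_apply, eq_comm, Complex.ofReal_eq_zero, mul_eq_zero] at h1
      have h2 := h1.resolve_left hc.ne'
      rw [integral_eq_zero_iff_of_nonneg
        (fun _ => Finset.sum_nonneg fun _ _ => by positivity)] at h2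
      · filter_upwards [h2] with x hx j
        have := (Finset.sum_eq_zero_iff_of_nonneg (fun j _ => by positivity)).mp hx j
          (Finset.mem_univ j)
        simpa using this
      · exact integrable_finsetSum _ fun l _ =>
          (memLp_two_iff_integrable_sq_norm (((hmem P).mp hP).2 i l).1).mp (((hmem P).mp hP).2 i l)
    -- Off the null set `D = 0` both `|D|^{1/2}` and `G` can be cancelled from `twist G P x = 0`.
    filter_upwards [ae_all_iff.mpr hz, ae_D_ne_zero] with x hx hD
    have h1 : twist G P x = 0 := by
      ext i j
      exact hx i j
    have hs : ((Real.sqrt |D x| : ℝ) : ℂ) ≠ 0 := by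
      rw [Complex.ofReal_ne_zero]
      exact (Real.sqrt_pos.mpr (abs_pos.mpr hD)).ne'
    have h2 : P x * G x = 0 := (smul_eq_zero.mp h1).resolve_left hs
    exact (hGu x hD).mul_left_eq_zero.mp h2

theorem eq_zero_of_continuous (hB : IsMatrixInnerProduct (L2 (weight G)) B)
    (hG : Continuous G) {P : Fn L} (hP : Continuous P) (h : B P P = 0) : P = 0 :=
  (hP.ae_eq_iff_eq da continuous_zero).mp (hB.definite P (continuous_mem_L2_weight hG hP) h)

end Weight

theorem DI_eq_weight (L : ℕ) : DI L = weight 1 := by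
  ext x : 1
  simp [DI, weight]

theorem abs_D_smul_mul {L : ℕ} (P R : Fn L) (x : A) :
    ((|D x| : ℝ) : ℂ) • (P x * (R x)ᴴ) = P x * weight 1 x * (R x)ᴴ := by
  simp [weight]

theorem pairing_eq {L : ℕ} (P R : Fn L) : pairing P R =
    ((2 / Real.pi : ℝ) : ℂ) • matInt fun x => P x * weight 1 x * (R x)ᴴ := by
  simp only [pairing, abs_D_smul_mul]

/-! ### Orthogonality -/

theorem integral_abs_D_mul_Phi (L d d' : ℕ) (p q : Fin (L + 1)) :
    ∫ x, (((|D x| : ℝ) : ℂ) • (Phi L d x * (Phi L d' x)ᴴ)) p q ∂da =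
      Real.pi / 2 * if d = d' ∧ p = q then
        ((L : ℂ) + 1) ^ 2 / (((d : ℂ) + p + 1) * ((d : ℂ) + (L - p) + 1)) else 0 := by
  rw [integral_da]
  · have : ∀ t, (((|D (a t)| : ℝ) : ℂ) • (Phi L d (a t) * (Phi L d' (a t))ᴴ)) p q =
        ((Real.sin t ^ 2 : ℝ) : ℂ) * (Phi L d (a t) * (Phi L d' (a t))ᴴ) p q := by
      intro t
      rw [D_a, abs_of_nonneg (sq_nonneg _), Matrix.smul_apply, smul_eq_mul]
    simp_rw [this]
    rw [integral_sin_sq_mul_Phi]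
    ring
  · exact (Continuous.smul (Complex.continuous_ofReal.comp (continuous_abs.comp continuous_D))
      ((continuous_Phi L d).matrix_mul (continuous_Phi L d').matrix_conjTranspose)).matrix_elem p q

theorem norm_formula (L d : ℕ) (p : Fin (L + 1)) :
    (((2 * ((L : ℝ) / 2) + 1) ^ 2 / (((d : ℝ) + (L : ℝ) / 2 + idx L p + 1) *
      ((d : ℝ) + (L : ℝ) / 2 - idx L p + 1)) : ℝ) : ℂ) =
      ((L : ℂ) + 1) ^ 2 / (((d : ℂ) + p + 1) * ((d : ℂ) + (L - p) + 1)) := by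
  rw [idx]
  push_cast
  congr 1
  · ring
  · ring

theorem pairing_Phi (L d d' : ℕ) (p q : Fin (L + 1)) :
    pairing (Phi L d) (Phi L d') p q =
      if d = d' ∧ p = q then
        (((2 * ((L : ℝ) / 2) + 1) ^ 2 / (((d : ℝ) + (L : ℝ) / 2 + idx L p + 1) *
          ((d : ℝ) + (L : ℝ) / 2 - idx L p + 1)) : ℝ) : ℂ)
      else 0 := by
  have hpi : (Real.pi : ℂ) ≠ 0 := Complex.ofReal_ne_zero.mpr Real.pi_ne_zero
  rw [pairing, Matrix.smul_apply, matInt, Matrix.of_apply, integral_abs_D_mul_Phi, norm_formula,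
    smul_eq_mul, ← mul_assoc]
  have : ((2 / Real.pi : ℝ) : ℂ) * (Real.pi / 2) = 1 := by
    push_cast
    field_simp
  rw [this, one_mul]

theorem Q_mul_V_mul_Q (L d d' : ℕ) {x : A} (hx : D x ≠ 0) :
    Q L d x * V L x * (Q L d' x)ᴴ = ((|D x| : ℝ) : ℂ) • (Phi L d x * (Phi L d' x)ᴴ) := by
  have hu := (Matrix.isUnit_iff_isUnit_det _).mp (isUnit_Phi_zero_of_D_ne_zero L hx)
  have h : ∀ d, Q L d x * Phi L 0 x = Phi L d x := by
    intro d
    rw [Q, Matrix.mul_assoc, Matrix.nonsing_inv_mul _ hu, Matrix.mul_one]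
  rw [V, Matrix.mul_smul, Matrix.smul_mul, ← Matrix.mul_assoc, h, Matrix.mul_assoc,
    ← Matrix.conjTranspose_mul, h]

/-- `Q` need not be continuous where `Φ_0` is singular; measurability comes from the adjugate
formula, and `Q V Q*` agrees almost everywhere with the continuous function `|D| Φ_d Φ_d*`. -/
theorem Q_mem_L2 (L d : ℕ) : Q L d ∈ L2 (V L) := by
  refine ⟨fun i j => ?_, fun i => ?_⟩
  · simp only [Q, Matrix.mul_apply, Matrix.inv_def, Matrix.smul_apply, smul_eq_mul,
      Ring.inverse_eq_inv']
    refine Finset.aestronglyMeasurable_fun_sum _ fun l _ => ?_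
    refine ((continuous_Phi L d).matrix_elem i l).aestronglyMeasurable.mul ?_
    refine AEStronglyMeasurable.mul ?_
      ((continuous_Phi L 0).matrix_adjugate.matrix_elem l j).aestronglyMeasurable
    exact (continuous_Phi L 0).matrix_det.measurable.inv.aestronglyMeasurable
  · have hc : Continuous fun x => (((|D x| : ℝ) : ℂ) • (Phi L d x * (Phi L d x)ᴴ)) i i :=
      (Continuous.smul (Complex.continuous_ofReal.comp (continuous_abs.comp continuous_D))
        ((continuous_Phi L d).matrix_mul (continuous_Phi L d).matrix_conjTranspose)).matrix_elem i i
    refine (integrable_da hc).congr ?_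
    filter_upwards [ae_D_ne_zero] with x hx
    rw [Q_mul_V_mul_Q L d d hx]

theorem pairingV_Q (L d d' : ℕ) (p q : Fin (L + 1)) :
    pairingV (Q L d) (Q L d') p q =
      if d = d' ∧ p = q then
        ((Real.pi / 2 * ((2 * ((L : ℝ) / 2) + 1) ^ 2 / (((d : ℝ) + (L : ℝ) / 2 + idx L p + 1) *
          ((d : ℝ) + (L : ℝ) / 2 - idx L p + 1))) : ℝ) : ℂ)
      else 0 := by
  have e : pairingV (Q L d) (Q L d') p q =
      ∫ x, (((|D x| : ℝ) : ℂ) • (Phi L d x * (Phi L d' x)ᴴ)) p q ∂da := by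
    refine integral_congr_ae ?_
    filter_upwards [ae_D_ne_zero] with x hx
    rw [Q_mul_V_mul_Q L d d' hx]
  rw [e, integral_abs_D_mul_Phi, Complex.ofReal_mul, norm_formula, mul_ite, mul_zero]
  push_cast
  rfl

end SphericalSU2

end

open SphericalSU2 in
theorem mainTheorem9 (L : ℕ) :
    -- the pairing is a matrix valued inner product (and its integrals converge)
    (∀ P ∈ L2 (DI L), ∀ R ∈ L2 (DI L), ∀ i j,
      MeasureTheory.Integrable
        (fun x => (((|D x| : ℝ) : ℂ) • (P x * (R x).conjTranspose)) i j) da) ∧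
    IsMatrixInnerProduct (L2 (DI L)) pairing ∧
    (∀ P : Fn L, Continuous P → P ∈ L2 (DI L) ∧ (pairing P P = 0 → P = 0)) ∧
    -- the full spherical functions are orthogonal, with explicit diagonal norms
    (∀ d, Continuous (Phi L d)) ∧
    (∀ (d d' : ℕ) (p q : Fin (L + 1)),
      pairing (Phi L d) (Phi L d') p q =
        if d = d' ∧ p = q then
          (((2 * ((L : ℝ) / 2) + 1) ^ 2 /
            (((d : ℝ) + (L : ℝ) / 2 + idx L p + 1) *
              ((d : ℝ) + (L : ℝ) / 2 - idx L p + 1)) : ℝ) : ℂ)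
        else 0) ∧
    -- the full spherical polynomials are well defined on the regular part
    (∀ x ∈ Areg, IsUnit (Phi L 0 x)) ∧
    -- the pairing with weight V is a matrix valued inner product
    (∀ P ∈ L2 (V L), ∀ R ∈ L2 (V L), ∀ i j,
      MeasureTheory.Integrable
        (fun x => (P x * V L x * (R x).conjTranspose) i j) da) ∧
    IsMatrixInnerProduct (L2 (V L)) pairingV ∧
    (∀ P : Fn L, Continuous P → P ∈ L2 (V L) ∧ (pairingV P P = 0 → P = 0)) ∧
    -- the full spherical polynomials are orthogonal for the weight V
    (∀ d, Q L d ∈ L2 (V L)) ∧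
    (∀ (d d' : ℕ) (p q : Fin (L + 1)),
      pairingV (Q L d) (Q L d') p q =
        if d = d' ∧ p = q then
          ((Real.pi / 2 * ((2 * ((L : ℝ) / 2) + 1) ^ 2 /
            (((d : ℝ) + (L : ℝ) / 2 + idx L p + 1) *
              ((d : ℝ) + (L : ℝ) / 2 - idx L p + 1))) : ℝ) : ℂ)
        else 0) := by
  have hpi : (0 : ℝ) < 2 / Real.pi := by positivity
  have h1 : Continuous (1 : Fn L) := continuous_const
  have hB : IsMatrixInnerProduct (L2 (DI L)) pairing := by
    rw [DI_eq_weight]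
    exact isMatrixInnerProduct_weight h1 (fun _ _ => isUnit_one) hpi pairing_eq
  have hV : IsMatrixInnerProduct (L2 (V L)) pairingV :=
    -- `V L` is `weight (Phi L 0)` by definition, and the constant in front of the integral is 1.
    isMatrixInnerProduct_weight (continuous_Phi L 0)
      (fun _ => isUnit_Phi_zero_of_D_ne_zero L) one_pos fun P R => by
        rw [Complex.ofReal_one, one_smul]
        rfl
  refine ⟨fun P hP R hR i j => ?_, hB, fun P hP => ?_, continuous_Phi L, pairing_Phi L, ?_,
    fun P hP R hR i j => ?_, hV, fun P hP => ?_, Q_mem_L2 L, pairingV_Q L⟩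
  · simp only [abs_D_smul_mul]
    rw [DI_eq_weight] at hP hR
    exact integrable_mul_weight_mul h1 hP hR i j
  · rw [DI_eq_weight] at hB ⊢
    exact ⟨continuous_mem_L2_weight h1 hP, eq_zero_of_continuous hB h1 hP⟩
  · rintro x ⟨t, ht, rfl⟩
    refine isUnit_Phi_zero L fun h => ?_
    obtain ⟨n, hn⟩ := Real.sin_eq_zero_iff.mp h
    exact ht n hn.symm
  · exact integrable_mul_weight_mul (continuous_Phi L 0) hP hR i j
  · exact ⟨continuous_mem_L2_weight (continuous_Phi L 0) hP,
      eq_zero_of_continuous hV (continuous_Phi L 0) hP⟩
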